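/- Let $(\Omega,\mathcal F,P)$ be a probability space, $\mathbb K\in\{\mathbb R,\mathbb C\}$, let $L^0(\mathcal F,\mathbb K)$ be the algebra of equivalence classes (modulo almost sure equality) of $\mathbb K$-valued random variables, and $L^0_+(\mathcal F)=\{\xi\in L^0(\mathcal F,\mathbb R):\xi\ge 0\}$, where inequalities, suprema $\bigvee$ and infima $\bigwedge$ refer to the almost sure order. Let $(S,\|\cdot\|)$ be a random normed module over $\mathbb K$ with base $(\Omega,\mathcal F,P)$: $S$ is a module over $L^0(\mathcal F,\mathbb K)$ and $\|\cdot\|:S\to L^0_+(\mathcal F)$ satisfies $\|x\|=0\Rightarrow x=0$, $\|\zeta x\|=|\zeta|\,\|x\|$ and $\|x+y\|\le\|x\|+\|y\|$ for all $\zeta\in L^0(\mathcal F,\mathbb K)$ and $x,y\in S$. Equip $S$ with the $(\varepsilon,\lambda)$-topology, in which the sets $\{z\in S: P(\|z\|<\varepsilon)>1-\lambda\}$, $\varepsilon>0$, $0<\lambda<1$, form a base of neighbourhoods of $0$, and assume that $S$ is complete. Let $B(S)$ be the set of $\mathbb K$-linear maps $T:S\to S$ for which there is an $\eta\in L^0_+(\mathcal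 F)$ with $\|Tz\|\le\eta\|z\|$ for all $z\in S$, and let $\|T\|$ be the infimum $\bigwedge$ of all such $\eta$. Let $C\in B(S)$ be injective. A family $\{W(s):s\ge 0\}\subset B(S)$ is a $C$-semigroup if $CW(s+t)=W(t)W(s)$ for all $s,t\ge0$, $W(0)=C$, and $s\mapsto W(s)x$ is continuous from $[0,\infty)$ to $S$ for every $x\in S$. It is locally almost surely bounded if $\bigvee_{s\in[0,l]}\|W(s)\|\in L^0_+(\mathcal F)$ for every $l>0$. Its infinitesimal generator is the map $A:D(A)\to S$, where $D(A)$ is the set of all $x\in S$ for which $\lim_{s\to0^+}\frac{W(s)x-Cx}{s}$ exists in $S$ and belongs to the range of $C$, and $Ax=C^{-1}\lim_{s\to0^+}\frac{W(s)x-Cx}{s}$ for $x\in D(A)$. **Proposition 4.4.** Let $\{W(s):s\ge0\}$ and $\{V(s):s\ge0\}$ be two locally almost surely bounded $C$-semigroups on $S$ with infinitesimal generators $(A,D(A))$ and $(B,D(B))$, respectively. If $A=B$ (that is, $D(A)=D(B)$ and $Ax=Bx$ for all $x\in D(A)$), then $W(s)=V(s)$ for every $s\ge0$. -/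

import Mathlib

open MeasureTheory Filter Topology
open scoped NNReal

/-- The pointwise a.e. operations make the space of equivalence classes a commutative ring. -/
noncomputable instance aeEqFunCommRing {Ω : Type*} [MeasurableSpace Ω] {P : Measure Ω}
    {R : Type*} [TopologicalSpace R] [CommRing R] [IsTopologicalRing R] :
    CommRing (Ω →ₘ[P] R) where
  __ := AEEqFun.instAddCommGroup
  __ := AEEqFun.instCommMonoid
  left_distrib := fun a b c => by
    change a * (b + c) = a * b + a * c
    induction a, b, c using AEEqFun.induction_on₃ with
    | _ f _ g _ h _ => simp only [AEEqFun.mk_mul_mk, AEEqFun.mk_add_mk, mul_add]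
  right_distrib := fun a b c => by
    change (a + b) * c = a * c + b * c
    induction a, b, c using AEEqFun.induction_on₃ with
    | _ f _ g _ h _ => simp only [AEEqFun.mk_mul_mk, AEEqFun.mk_add_mk, add_mul]
  zero_mul := fun a => by
    induction a using AEEqFun.induction_on with
    | _ f _ => exact congrArg _ (Subtype.ext (zero_mul f))
  mul_zero := fun a => by
    induction a using AEEqFun.induction_on with
    | _ f _ => exact congrArg _ (Subtype.ext (mul_zero f))

/-- The modulus `|ζ|` of the class of a `𝕜`-valued random variable `ζ`. -/
noncomputable def l0Abs {Ω : Type*} [MeasurableSpace Ω] {P : Measure Ω} {𝕜 : Type*} [RCLike 𝕜]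
    (ζ : Ω →ₘ[P] 𝕜) : Ω →ₘ[P] ℝ :=
  AEEqFun.comp (fun c : 𝕜 => ‖c‖) continuous_norm ζ

/-- An `L⁰`-norm on a module `S` over `L⁰(𝓕, 𝕜)`, where `L⁰(𝓕, 𝕜)` is the ring `Ω →ₘ[P] 𝕜` of
classes of `𝕜`-valued random variables. The pair of `S` and the `L⁰`-norm is a random normed module
over `𝕜` with base `(Ω, 𝓕, P)`. -/
structure RandomNorm {Ω : Type*} [MeasurableSpace Ω] (P : Measure Ω) (𝕜 : Type*) [RCLike 𝕜]
    (S : Type*) [AddCommGroup S] [Module (Ω →ₘ[P] 𝕜) S] where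
  /-- the `L⁰`-norm `‖x‖` -/
  norm : S → (Ω →ₘ[P] ℝ)
  norm_nonneg : ∀ x, 0 ≤ norm x
  eq_zero_of_norm_eq_zero : ∀ x, norm x = 0 → x = 0
  norm_smul : ∀ (ζ : Ω →ₘ[P] 𝕜) (x : S), norm (ζ • x) = l0Abs ζ * norm x
  norm_add_le : ∀ x y, norm (x + y) ≤ norm x + norm y

namespace RandomNorm

variable {Ω : Type*} [MeasurableSpace Ω] {P : Measure Ω} {𝕜 : Type*} [RCLike 𝕜]
  {S : Type*} [AddCommGroup S] [Module (Ω →ₘ[P] 𝕜) S] (N : RandomNorm P 𝕜 S)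

/-- The set `{z | P {ω | ‖z‖(ω) < ε} > 1 - δ}`. -/
def nhdZero (ε δ : ℝ) : Set S :=
  {z | 1 - δ < P.real {ω | N.norm z ω < ε}}

theorem norm_zero : N.norm 0 = 0 := by
  have h := N.norm_smul 0 0
  rw [zero_smul (Ω →ₘ[P] 𝕜) (0 : S)] at h
  rw [h]
  have h0 : l0Abs (0 : Ω →ₘ[P] 𝕜) = 0 := by
    rw [AEEqFun.zero_def, l0Abs, AEEqFun.comp_mk, AEEqFun.zero_def]
    congr 1
    funext ω
    simp
  rw [h0, zero_mul]

theorem norm_neg (x : S) : N.norm (-x) = N.norm x := by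
  have h := N.norm_smul (-1) x
  rw [neg_one_smul (Ω →ₘ[P] 𝕜) x] at h
  rw [h]
  have h0 : l0Abs (-1 : Ω →ₘ[P] 𝕜) = 1 := by
    change AEEqFun.mk _ _ = AEEqFun.mk _ _
    apply AEEqFun.mk_eq_mk.mpr
    filter_upwards [AEEqFun.coeFn_neg (1 : Ω →ₘ[P] 𝕜),
      AEEqFun.coeFn_one (α := Ω) (β := 𝕜) (μ := P)] with ω h h'
    simp
  rw [h0, one_mul]

theorem nhdZero_mono [IsProbabilityMeasure P] {ε ε' δ δ' : ℝ} (hε : ε ≤ ε') (hδ : δ ≤ δ') :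
    N.nhdZero ε δ ⊆ N.nhdZero ε' δ' := by
  intro z hz
  have h : P.real {ω | N.norm z ω < ε} ≤ P.real {ω | N.norm z ω < ε'} :=
    measureReal_mono fun ω (hω : N.norm z ω < ε) => lt_of_lt_of_le hω hε
  have hz' : 1 - δ < P.real {ω | N.norm z ω < ε} := hz
  show 1 - δ' < P.real {ω | N.norm z ω < ε'}
  linarith

theorem zero_mem_nhdZero [IsProbabilityMeasure P] {ε δ : ℝ} (hε : 0 < ε) (hδ : 0 < δ) :
    (0 : S) ∈ N.nhdZero ε δ := by
  show 1 - δ < P.real {ω | N.norm 0 ω < ε}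
  have h : {ω | N.norm 0 ω < ε} =ᵐ[P] (Set.univ : Set Ω) := by
    rw [N.norm_zero]
    filter_upwards [AEEqFun.coeFn_zero (α := Ω) (β := ℝ) (μ := P)] with ω hω
    apply propext
    show ((0 : Ω →ₘ[P] ℝ) ω < ε) ↔ True
    rw [hω]
    simpa using hε
  rw [measureReal_congr h]
  simp [hδ]

theorem add_mem_nhdZero [IsProbabilityMeasure P] {ε δ : ℝ} {x y : S}
    (hx : x ∈ N.nhdZero (ε / 2) (δ / 2)) (hy : y ∈ N.nhdZero (ε / 2) (δ / 2)) :
    x + y ∈ N.nhdZero ε δ := by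
  have hx' : 1 - δ / 2 < P.real {ω | N.norm x ω < ε / 2} := hx
  have hy' : 1 - δ / 2 < P.real {ω | N.norm y ω < ε / 2} := hy
  show 1 - δ < P.real {ω | N.norm (x + y) ω < ε}
  have hmy : NullMeasurableSet {ω | N.norm y ω < ε / 2} P :=
    nullMeasurableSet_lt (N.norm y).aestronglyMeasurable.aemeasurable aemeasurable_const
  have h1 : P.real ({ω | N.norm x ω < ε / 2} ∩ {ω | N.norm y ω < ε / 2}) ≤
      P.real {ω | N.norm (x + y) ω < ε} := by
    refine ENNReal.toReal_mono (measure_ne_top P _) (measure_mono_ae ?_)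
    filter_upwards [AEEqFun.coeFn_le.mpr (N.norm_add_le x y),
      AEEqFun.coeFn_add (N.norm x) (N.norm y)] with ω h h' hω
    have h1 : N.norm x ω < ε / 2 := hω.1
    have h2 : N.norm y ω < ε / 2 := hω.2
    rw [h', Pi.add_apply] at h
    show N.norm (x + y) ω < ε
    linarith
  have h2 := measureReal_union_add_inter₀ (μ := P) (s := {ω | N.norm x ω < ε / 2}) hmy
  have h3 : P.real ({ω | N.norm x ω < ε / 2} ∪ {ω | N.norm y ω < ε / 2}) ≤ 1 :=
    measureReal_le_one
  linarith

/-- The sets `nhdZero ε δ`, for `ε > 0` and `0 < δ < 1`, as a base at zero of a group topology. -/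
@[reducible]
def basis [IsProbabilityMeasure P] : AddGroupFilterBasis S :=
  addGroupFilterBasisOfComm
    {U | ∃ ε δ : ℝ, 0 < ε ∧ 0 < δ ∧ δ < 1 ∧ U = N.nhdZero ε δ}
    ⟨N.nhdZero 1 (1 / 2), 1, 1 / 2, by norm_num, by norm_num, by norm_num, rfl⟩
    (by
      rintro _ _ ⟨ε, δ, hε, hδ, hδ1, rfl⟩ ⟨ε', δ', hε', hδ', hδ1', rfl⟩
      exact ⟨_, ⟨min ε ε', min δ δ', lt_min hε hε', lt_min hδ hδ', min_lt_of_left_lt hδ1, rfl⟩,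
        Set.subset_inter (N.nhdZero_mono (min_le_left _ _) (min_le_left _ _))
          (N.nhdZero_mono (min_le_right _ _) (min_le_right _ _))⟩)
    (by
      rintro _ ⟨ε, δ, hε, hδ, -, rfl⟩
      exact N.zero_mem_nhdZero hε hδ)
    (by
      rintro _ ⟨ε, δ, hε, hδ, hδ1, rfl⟩
      refine ⟨_, ⟨ε / 2, δ / 2, by linarith, by linarith, by linarith, rfl⟩, ?_⟩
      rintro _ ⟨x, hx, y, hy, rfl⟩
      exact N.add_mem_nhdZero hx hy)
    (by
      rintro _ ⟨ε, δ, hε, hδ, hδ1, rfl⟩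
      refine ⟨_, ⟨ε, δ, hε, hδ, hδ1, rfl⟩, ?_⟩
      intro x hx
      show 1 - δ < P.real {ω | N.norm (-x) ω < ε}
      rw [N.norm_neg]
      exact hx)

/-- The `(ε, λ)`-topology on `S`. -/
@[reducible]
def topology [IsProbabilityMeasure P] : TopologicalSpace S :=
  N.basis.topology

/-- The translation-invariant uniform structure of the `(ε, λ)`-topology. -/
@[reducible]
def uniformSpace [IsProbabilityMeasure P] : UniformSpace S :=
  @IsTopologicalAddGroup.rightUniformSpace S _ N.topology N.basis.isTopologicalAddGroup

/-- Completeness of `S` for the `(ε, λ)`-topology. -/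
def IsComplete [IsProbabilityMeasure P] : Prop :=
  @CompleteSpace S N.uniformSpace

/-- `B(S)`: the almost surely bounded `𝕜`-linear operators on `S`, where a scalar `c : 𝕜` acts on
`S` through the constant random variable `c`. -/
structure BoundedOp where
  toFun : S → S
  map_add' : ∀ x y, toFun (x + y) = toFun x + toFun y
  map_smul' : ∀ (c : 𝕜) (x : S),
    toFun ((AEEqFun.const Ω c : Ω →ₘ[P] 𝕜) • x) = (AEEqFun.const Ω c : Ω →ₘ[P] 𝕜) • toFun x
  bounded' : ∃ η : Ω →ₘ[P] ℝ, 0 ≤ η ∧ ∀ z, N.norm (toFun z) ≤ η * N.norm z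

namespace BoundedOp

variable {N}

instance : FunLike N.BoundedOp S S where
  coe := BoundedOp.toFun
  coe_injective := by
    rintro ⟨f, _, _, _⟩ ⟨g, _, _, _⟩ h
    cases h
    rfl

/-- The almost sure bounds `η ∈ L⁰₊` of an operator: `‖T z‖ ≤ η ‖z‖` for all `z`. -/
def bounds (T : N.BoundedOp) : Set (Ω →ₘ[P] ℝ) :=
  {η | 0 ≤ η ∧ ∀ z, N.norm (T z) ≤ η * N.norm z}

theorem exists_mem_bounds_le (T : N.BoundedOp) (f : ℕ → Ω →ₘ[P] ℝ) (hf : ∀ n, f n ∈ T.bounds) :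
    ∃ g ∈ T.bounds, ∀ n, g ≤ f n := by
  have hnn : ∀ᵐ ω ∂P, ∀ n, 0 ≤ f n ω := by
    rw [ae_all_iff]
    intro n
    filter_upwards [AEEqFun.coeFn_le.mpr (hf n).1, AEEqFun.coeFn_zero (α := Ω) (β := ℝ) (μ := P)]
      with ω h h0
    rwa [h0] at h
  have hm : AEStronglyMeasurable (fun ω => ⨅ n, f n ω) P :=
    (AEMeasurable.iInf fun n => (f n).aestronglyMeasurable.aemeasurable).aestronglyMeasurable
  refine ⟨AEEqFun.mk _ hm, ⟨?_, ?_⟩, ?_⟩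
  · rw [← AEEqFun.coeFn_le]
    filter_upwards [hnn, AEEqFun.coeFn_mk _ hm, AEEqFun.coeFn_zero (α := Ω) (β := ℝ) (μ := P)]
      with ω h h1 h0
    rw [h1, h0]
    exact Real.iInf_nonneg h
  · intro z
    rw [← AEEqFun.coeFn_le]
    have hz : ∀ᵐ ω ∂P, ∀ n, N.norm (T z) ω ≤ f n ω * N.norm z ω := by
      rw [ae_all_iff]
      intro n
      filter_upwards [AEEqFun.coeFn_le.mpr ((hf n).2 z), AEEqFun.coeFn_mul (f n) (N.norm z)]
        with ω h h0
      rwa [h0] at h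
    filter_upwards [hz, AEEqFun.coeFn_mk _ hm, AEEqFun.coeFn_mul (AEEqFun.mk _ hm) (N.norm z),
      AEEqFun.coeFn_le.mpr (N.norm_nonneg z), AEEqFun.coeFn_zero (α := Ω) (β := ℝ) (μ := P)]
      with ω h h1 h2 h3 h0
    rw [h0] at h3
    rw [h2, Pi.mul_apply, h1, Real.iInf_mul_of_nonneg h3]
    exact le_ciInf h
  · intro n
    rw [← AEEqFun.coeFn_le]
    filter_upwards [hnn, AEEqFun.coeFn_mk _ hm] with ω h h1
    rw [h1]
    exact ciInf_le ⟨0, by rintro _ ⟨k, rfl⟩; exact h k⟩ n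

/-- The set of almost sure bounds has a least element, so its infimum exists. -/
theorem exists_isLeast_bounds [IsProbabilityMeasure P] (T : N.BoundedOp) :
    ∃ η, IsLeast T.bounds η := by
  let I : (Ω →ₘ[P] ℝ) → ℝ := fun f => ∫ ω, Real.arctan (f ω) ∂P
  have hint : ∀ f : Ω →ₘ[P] ℝ, Integrable (fun ω => Real.arctan (f ω)) P := fun f =>
    Integrable.of_bound
      (Real.continuous_arctan.comp_aestronglyMeasurable f.aestronglyMeasurable) (Real.pi / 2)
      (Eventually.of_forall fun ω => by
        rw [Real.norm_eq_abs, abs_le]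
        exact ⟨(Real.neg_pi_div_two_lt_arctan _).le, (Real.arctan_lt_pi_div_two _).le⟩)
  have hmono : ∀ {f g : Ω →ₘ[P] ℝ}, f ≤ g →
      (fun ω => Real.arctan (f ω)) ≤ᵐ[P] fun ω => Real.arctan (g ω) := by
    intro f g hfg
    filter_upwards [AEEqFun.coeFn_le.mpr hfg] with ω h
    exact Real.arctan_mono h
  have hImono : ∀ {f g : Ω →ₘ[P] ℝ}, f ≤ g → I f ≤ I g := fun h =>
    integral_mono_ae (hint _) (hint _) (hmono h)
  have hne : (I '' T.bounds).Nonempty := by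
    obtain ⟨η, h⟩ := T.bounded'
    exact ⟨_, η, h, rfl⟩
  have hbdd : BddBelow (I '' T.bounds) := by
    refine ⟨0, ?_⟩
    rintro _ ⟨f, hf, rfl⟩
    apply integral_nonneg_of_ae
    filter_upwards [AEEqFun.coeFn_le.mpr hf.1, AEEqFun.coeFn_zero (α := Ω) (β := ℝ) (μ := P)]
      with ω h h0
    rw [h0] at h
    exact Real.arctan_nonneg.mpr h
  obtain ⟨u, -, hu, hmem⟩ := exists_seq_tendsto_sInf hne hbdd
  choose f hf hfu using hmem
  obtain ⟨g, hg, hgf⟩ := T.exists_mem_bounds_le f hf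
  refine ⟨g, hg, fun k hk => ?_⟩
  obtain ⟨h, hh, hle⟩ := T.exists_mem_bounds_le (fun n => if n = 0 then g else k)
    (by intro n; split_ifs <;> assumption)
  have hhg : h ≤ g := by simpa using hle 0
  have hhk : h ≤ k := by simpa using hle 1
  have h1 : I g ≤ sInf (I '' T.bounds) :=
    ge_of_tendsto' hu fun n => (hImono (hgf n)).trans (hfu n).le
  have h2 : sInf (I '' T.bounds) ≤ I h := csInf_le hbdd ⟨h, hh, rfl⟩
  have h3 : (fun ω => Real.arctan (h ω)) =ᵐ[P] fun ω => Real.arctan (g ω) :=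
    (integral_eq_iff_of_ae_le (hint _) (hint _) (hmono hhg)).mp
      (le_antisymm (hImono hhg) (h1.trans h2))
  have h4 : h = g := by
    apply AEEqFun.ext
    filter_upwards [h3] with ω hω
    exact Real.arctan_injective hω
  rw [← h4]
  exact hhk

/-- The `L⁰`-norm of an operator: `‖T‖ = ⋀ {η ∈ L⁰₊ | ‖T z‖ ≤ η ‖z‖ for all z}`. -/
noncomputable def opNorm [IsProbabilityMeasure P] (T : N.BoundedOp) : Ω →ₘ[P] ℝ :=
  Classical.choose (p := fun η => IsGLB T.bounds η)
    (T.exists_isLeast_bounds.imp fun _ h => h.isGLB)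

theorem isGLB_opNorm [IsProbabilityMeasure P] (T : N.BoundedOp) : IsGLB T.bounds T.opNorm :=
  Classical.choose_spec (p := fun η => IsGLB T.bounds η)
    (T.exists_isLeast_bounds.imp fun _ h => h.isGLB)

end BoundedOp

/-- `W` is a `C`-semigroup on `S`; the index set `[0, ∞)` is `ℝ≥0`. -/
structure IsCSemigroup [IsProbabilityMeasure P] (C : N.BoundedOp) (W : ℝ≥0 → N.BoundedOp) :
    Prop where
  injective : Function.Injective C
  comp : ∀ (s t : ℝ≥0) (x : S), C (W (s + t) x) = W t (W s x)
  zero : W 0 = C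
  strongly_continuous : ∀ x : S, @Continuous ℝ≥0 S _ N.topology fun s => W s x

/-- `lim_{s → 0} (W(s) x - C x) / s = z` in the `(ε, λ)`-topology. -/
def HasDerivAtZero [IsProbabilityMeasure P] (C : N.BoundedOp) (W : ℝ≥0 → N.BoundedOp)
    (x z : S) : Prop :=
  Tendsto (fun s : ℝ≥0 => (AEEqFun.const Ω (((s : ℝ)⁻¹ : ℝ) : 𝕜) : Ω →ₘ[P] 𝕜) • (W s x - C x))
    (𝓝[>] 0) (@nhds S N.topology z)

/-- The infinitesimal generator `A : D(A) → S` as a partial function: `x ∈ D(A)` if the limit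
`lim_{s → 0} (W(s) x - C x) / s` exists and lies in the range of `C`, and `A x` is the
preimage under `C` of that limit. -/
noncomputable def generator [IsProbabilityMeasure P] (C : N.BoundedOp)
    (W : ℝ≥0 → N.BoundedOp) : S →. S := fun x =>
  { Dom := ∃ y, N.HasDerivAtZero C W x (C y)
    get := fun h => Classical.choose h }

/-- For every `l > 0`, the supremum of `{‖W(s)‖ | s ∈ [0, l]}` exists in `L⁰₊`. -/
def LocallyASBounded [IsProbabilityMeasure P] (W : ℝ≥0 → N.BoundedOp) : Prop :=
  ∀ l : ℝ≥0, 0 < l → ∃ M : Ω →ₘ[P] ℝ, 0 ≤ M ∧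
    IsLUB {ξ : Ω →ₘ[P] ℝ | ∃ s ∈ Set.Icc 0 l, ξ = (W s).opNorm} M

end RandomNorm

/-! Fix `x` and put p(t) = ∫₀ᵗ W(r)x dr and q(t) = ∫₀ᵗ V(r)x dr. Each primitive stays in the domain
of its generator, with Ap(t) = W(t)x - Cx and Bq(t) = V(t)x - Cx (`hasDerivAtZero_primitive`). As A
= B, the curve w = p - q solves w' = Bw, w(0) = 0. Then r ↦ V(t-r)w(r) has zero derivative, hence is
constant, so Cw(t) = V(t)w(0) = 0 and w(t) = 0 because C is injective (`eq_zero_of_isPrimitive`).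
Differentiating w = 0 gives W(s)x = V(s)x.

The (ε, λ)-topology is in general not locally convex, so neither integrals nor mean value estimates
are available in it directly. The calculus is done instead with the gauges E[‖z‖ / D], D ≥ 1.
Elements of finite gauge form a Banach space, where orbits dominated by D are continuous and have
Bochner integrals (`exists_isPrimitive`). An operator with almost sure bound E maps the gauge of D
into the gauge of E·D, so the weight may grow from one estimate to the next. This costs nothing,
since every gauge separates points.

The difference quotient defining the generator converges only in probability, with no dominating
variable. Along a suitable sequence it does converge in some gauge (`exists_weight_frequently_lt`).
This suffices, since a curve whose lower right derivative vanishes is already constant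
(`eq_zero_of_frequently_gauge_sub_le`). The outcome is the integrated form `eq_add_primitive`. -/

namespace RandomNorm

variable {Ω : Type*} [MeasurableSpace Ω] {P : Measure Ω} {𝕜 : Type*} [RCLike 𝕜]
  {S : Type*} [AddCommGroup S] [Module (Ω →ₘ[P] 𝕜) S] (N : RandomNorm P 𝕜 S)

/-! ### Real scalars and pointwise forms of the norm axioms -/

section RealScalars

variable (P 𝕜) in
/-- The action of a real number on a module over `L⁰(𝓕, 𝕜)` through the constant random variable. -/
noncomputable def rsmul (c : ℝ) (x : S) : S := (AEEqFun.const Ω (c : 𝕜) : Ω →ₘ[P] 𝕜) • x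

theorem const_add (a b : 𝕜) :
    (AEEqFun.const Ω (a + b) : Ω →ₘ[P] 𝕜) = AEEqFun.const Ω a + AEEqFun.const Ω b := rfl

theorem const_mul (a b : 𝕜) :
    (AEEqFun.const Ω (a * b) : Ω →ₘ[P] 𝕜) = AEEqFun.const Ω a * AEEqFun.const Ω b := rfl

theorem rsmul_add (c : ℝ) (x y : S) : rsmul P 𝕜 c (x + y) = rsmul P 𝕜 c x + rsmul P 𝕜 c y :=
  smul_add _ _ _

theorem rsmul_zero (c : ℝ) : rsmul P 𝕜 c (0 : S) = 0 := smul_zero _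

theorem rsmul_sub (c : ℝ) (x y : S) : rsmul P 𝕜 c (x - y) = rsmul P 𝕜 c x - rsmul P 𝕜 c y :=
  smul_sub _ _ _

theorem add_rsmul (c d : ℝ) (x : S) : rsmul P 𝕜 (c + d) x = rsmul P 𝕜 c x + rsmul P 𝕜 d x := by
  simp only [rsmul, RCLike.ofReal_add, const_add, add_smul]

theorem mul_rsmul (c d : ℝ) (x : S) : rsmul P 𝕜 (c * d) x = rsmul P 𝕜 c (rsmul P 𝕜 d x) := by
  simp only [rsmul, RCLike.ofReal_mul, const_mul, mul_smul]

theorem one_rsmul (x : S) : rsmul P 𝕜 1 x = x := by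
  have h : (AEEqFun.const Ω (((1 : ℝ) : 𝕜)) : Ω →ₘ[P] 𝕜) = 1 := by
    rw [RCLike.ofReal_one]; rfl
  rw [rsmul, h, one_smul]

theorem zero_rsmul (x : S) : rsmul P 𝕜 0 x = 0 := by
  have h := add_rsmul (P := P) (𝕜 := 𝕜) 0 0 x
  rwa [add_zero, left_eq_add] at h

theorem neg_rsmul (c : ℝ) (x : S) : rsmul P 𝕜 (-c) x = -rsmul P 𝕜 c x := by
  rw [eq_neg_iff_add_eq_zero, ← add_rsmul, neg_add_cancel, zero_rsmul]

end RealScalars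

theorem ae_norm_nonneg (x : S) : ∀ᵐ ω ∂P, 0 ≤ N.norm x ω := by
  filter_upwards [AEEqFun.coeFn_le.mpr (N.norm_nonneg x),
    AEEqFun.coeFn_zero (α := Ω) (β := ℝ) (μ := P)] with ω h h0
  rwa [h0] at h

theorem ae_norm_add_le (x y : S) : ∀ᵐ ω ∂P, N.norm (x + y) ω ≤ N.norm x ω + N.norm y ω := by
  filter_upwards [AEEqFun.coeFn_le.mpr (N.norm_add_le x y),
    AEEqFun.coeFn_add (N.norm x) (N.norm y)] with ω h h'
  rwa [h'] at h

theorem ae_norm_sub_le (x y : S) : ∀ᵐ ω ∂P, N.norm (x - y) ω ≤ N.norm x ω + N.norm y ω := by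
  have h := N.ae_norm_add_le x (-y)
  rwa [← sub_eq_add_neg, N.norm_neg] at h

theorem ae_norm_rsmul (c : ℝ) (x : S) :
    ∀ᵐ ω ∂P, N.norm (rsmul P 𝕜 c x) ω = |c| * N.norm x ω := by
  rw [rsmul, N.norm_smul]
  have h : (l0Abs (AEEqFun.const Ω (c : 𝕜)) : Ω →ₘ[P] ℝ) = AEEqFun.const Ω |c| := by
    rw [l0Abs, AEEqFun.const, AEEqFun.comp_mk, AEEqFun.const]
    congr 1
    funext ω
    simp
  rw [h]
  filter_upwards [AEEqFun.coeFn_mul (AEEqFun.const Ω |c|) (N.norm x),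
    AEEqFun.coeFn_const (μ := P) Ω |c|] with ω h1 h2
  rw [h1, Pi.mul_apply, h2, Function.const_apply]

theorem eq_zero_of_ae_norm (x : S) (h : ∀ᵐ ω ∂P, N.norm x ω ≤ 0) : x = 0 := by
  apply N.eq_zero_of_norm_eq_zero
  apply AEEqFun.ext
  filter_upwards [h, N.ae_norm_nonneg x, AEEqFun.coeFn_zero (α := Ω) (β := ℝ) (μ := P)]
    with ω h1 h2 h3
  rw [h3]
  exact le_antisymm h1 h2

theorem ae_norm_zero : ∀ᵐ ω ∂P, N.norm 0 ω = 0 := by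
  rw [N.norm_zero]
  exact AEEqFun.coeFn_zero

/-! ### Convergence in the `(ε, λ)`-topology -/

section Topology

variable [IsProbabilityMeasure P]

theorem tendsto_iff_eventually_mem {ι : Type*} {l : Filter ι} {f : ι → S} {z : S} :
    Tendsto f l (@nhds S N.topology z) ↔
      ∀ ε δ : ℝ, 0 < ε → 0 < δ → ∀ᶠ i in l, f i - z ∈ N.nhdZero ε δ := by
  rw [(N.basis.nhds_hasBasis z).tendsto_right_iff]
  constructor
  · intro h ε δ hε hδ
    -- Basic neighbourhoods require a second parameter below 1, so `δ` is first cut down.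
    have h1 := h (N.nhdZero ε (min δ (1 / 2)))
      ⟨ε, min δ (1 / 2), hε, lt_min hδ (by norm_num), (min_le_right _ _).trans_lt (by norm_num), rfl⟩
    filter_upwards [h1] with i hi
    obtain ⟨y, hy, hyi⟩ := hi
    have : f i - z = y := by rw [← hyi]; exact add_sub_cancel_left z y
    rw [this]
    exact N.nhdZero_mono le_rfl (min_le_left _ _) hy
  · rintro h _ ⟨ε, δ, hε, hδ, -, rfl⟩
    filter_upwards [h ε δ hε hδ] with i hi
    exact ⟨f i - z, hi, add_sub_cancel _ _⟩

theorem mem_nhdZero_iff {ε δ : ℝ} {z : S} :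
    z ∈ N.nhdZero ε δ ↔ P.real {ω | ε ≤ N.norm z ω} < δ := by
  have hm : MeasurableSet {ω | ε ≤ N.norm z ω} :=
    measurableSet_le measurable_const (N.norm z).measurable
  have h : {ω | N.norm z ω < ε} = {ω | ε ≤ N.norm z ω}ᶜ := by ext ω; simp
  show 1 - δ < P.real {ω | N.norm z ω < ε} ↔ _
  rw [h, probReal_compl_eq_one_sub hm]
  constructor <;> intro h <;> linarith

/-- The (ε, λ)-topology is that of convergence in probability of the norms; in this form Mathlib's
convergence in measure applies. -/
theorem tendsto_iff_measure {ι : Type*} {l : Filter ι} {f : ι → S} {z : S} :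
    Tendsto f l (@nhds S N.topology z) ↔
      ∀ ε : ℝ, 0 < ε → Tendsto (fun i => P {ω | ε ≤ N.norm (f i - z) ω}) l (𝓝 0) := by
  rw [N.tendsto_iff_eventually_mem]
  simp only [N.mem_nhdZero_iff]
  refine forall_congr' fun ε => ⟨fun h hε => ?_, fun h δ hε hδ => ?_⟩
  · rw [ENNReal.tendsto_nhds_zero]
    intro δ hδ
    rcases eq_or_ne δ ⊤ with rfl | hδt
    · simp
    filter_upwards [h δ.toReal hε (ENNReal.toReal_pos hδ.ne' hδt)] with i hi
    exact (ENNReal.toReal_le_toReal (measure_ne_top _ _) hδt).mp hi.le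
  · have h1 := (ENNReal.tendsto_nhds_zero.mp (h hε)) (ENNReal.ofReal (δ / 2))
      (ENNReal.ofReal_pos.mpr (by linarith))
    filter_upwards [h1] with i hi
    have := ENNReal.toReal_mono ENNReal.ofReal_ne_top hi
    rw [ENNReal.toReal_ofReal (by linarith)] at this
    exact this.trans_lt (by linarith)

theorem tendstoInMeasure_of_tendsto {ι : Type*} {l : Filter ι} {f : ι → S} {z : S}
    (h : Tendsto f l (@nhds S N.topology z)) :
    TendstoInMeasure P (fun i ω => N.norm (f i - z) ω) l (fun _ => 0) := by
  rw [tendstoInMeasure_iff_norm]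
  intro ε hε
  refine (N.tendsto_iff_measure.mp h ε hε).congr fun i => ?_
  apply measure_congr
  filter_upwards [N.ae_norm_nonneg (f i - z)] with ω hω
  apply propext
  show ε ≤ N.norm (f i - z) ω ↔ ε ≤ ‖N.norm (f i - z) ω - 0‖
  rw [sub_zero, Real.norm_of_nonneg hω]

end Topology

/-! ### Weighted `L¹`-gauges -/

/-- The gauge `E[‖z‖ / D]` attached to a random variable `D`. -/
noncomputable def gauge (D : Ω → ℝ) (z : S) : ENNReal :=
  ∫⁻ ω, ENNReal.ofReal (N.norm z ω / D ω) ∂P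

/-- A real random variable with values in `[1, ∞)`. -/
structure IsWeight (D : Ω → ℝ) : Prop where
  measurable : Measurable D
  one_le : ∀ ω, 1 ≤ D ω

theorem IsWeight.pos {D : Ω → ℝ} (hD : IsWeight D) (ω : Ω) : 0 < D ω :=
  zero_lt_one.trans_le (hD.one_le ω)

theorem IsWeight.max {D E : Ω → ℝ} (hD : IsWeight D) (hE : Measurable E) :
    IsWeight fun ω => max (D ω) (E ω) :=
  ⟨hD.measurable.max hE, fun ω => (hD.one_le ω).trans (le_max_left _ _)⟩

theorem IsWeight.mul {D E : Ω → ℝ} (hD : IsWeight D) (hE : IsWeight E) :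
    IsWeight fun ω => D ω * E ω :=
  ⟨hD.measurable.mul hE.measurable, fun ω => one_le_mul_of_one_le_of_one_le (hD.one_le ω) (hE.one_le ω)⟩

section Gauge

variable {D E : Ω → ℝ}

theorem measurable_gauge (hD : Measurable D) (z : S) :
    Measurable fun ω => ENNReal.ofReal (N.norm z ω / D ω) :=
  ((N.norm z).measurable.div hD).ennreal_ofReal

theorem gauge_zero : N.gauge D 0 = 0 := by
  rw [gauge, lintegral_congr_ae (g := fun _ => 0), lintegral_zero]
  filter_upwards [N.ae_norm_zero] with ω h
  simp [h]

theorem gauge_neg (z : S) : N.gauge D (-z) = N.gauge D z := by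
  rw [gauge, N.norm_neg, gauge]

theorem gauge_sub_rev (x y : S) : N.gauge D (x - y) = N.gauge D (y - x) := by
  rw [← N.gauge_neg, neg_sub]

theorem gauge_add_le (hD : IsWeight D) (x y : S) :
    N.gauge D (x + y) ≤ N.gauge D x + N.gauge D y := by
  rw [gauge, gauge, gauge, ← lintegral_add_left (N.measurable_gauge hD.measurable x)]
  apply lintegral_mono_ae
  filter_upwards [N.ae_norm_add_le x y] with ω h
  refine le_trans (ENNReal.ofReal_le_ofReal ?_) ENNReal.ofReal_add_le
  rw [← add_div]
  exact div_le_div_of_nonneg_right h (hD.pos ω).le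

theorem gauge_sub_le (hD : IsWeight D) (x y : S) :
    N.gauge D (x - y) ≤ N.gauge D x + N.gauge D y := by
  rw [sub_eq_add_neg, ← N.gauge_neg y]
  exact N.gauge_add_le hD _ _

theorem gauge_le_sub_add (hD : IsWeight D) (x y : S) :
    N.gauge D x ≤ N.gauge D (x - y) + N.gauge D y := by
  simpa using N.gauge_add_le hD (x - y) y

theorem gauge_rsmul (c : ℝ) (x : S) :
    N.gauge D (rsmul P 𝕜 c x) = ENNReal.ofReal |c| * N.gauge D x := by
  rw [gauge, gauge, ← lintegral_const_mul' _ _ ENNReal.ofReal_ne_top]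
  apply lintegral_congr_ae
  filter_upwards [N.ae_norm_rsmul c x] with ω h
  rw [h, mul_div_assoc, ENNReal.ofReal_mul (abs_nonneg c)]

theorem eq_zero_of_gauge_eq_zero (hD : IsWeight D) {z : S} (h : N.gauge D z = 0) : z = 0 := by
  rw [gauge, lintegral_eq_zero_iff (N.measurable_gauge hD.measurable z)] at h
  apply N.eq_zero_of_ae_norm
  filter_upwards [h] with ω hω
  rw [Pi.zero_apply, ENNReal.ofReal_eq_zero] at hω
  by_contra! hc
  exact absurd hω (not_le.mpr (div_pos hc (hD.pos ω)))

theorem gauge_anti (hD : IsWeight D) (h : ∀ ω, D ω ≤ E ω) (z : S) :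
    N.gauge E z ≤ N.gauge D z := by
  apply lintegral_mono_ae
  filter_upwards [N.ae_norm_nonneg z] with ω hω
  exact ENNReal.ofReal_le_ofReal (div_le_div_of_nonneg_left hω (hD.pos ω) (h ω))

/-- The bound `E` on the operator is absorbed into the weight, so no integrability of `E` is needed.
-/
theorem gauge_map_le (hD : IsWeight D) (hE : IsWeight E) {x y : S}
    (h : ∀ᵐ ω ∂P, N.norm y ω ≤ E ω * N.norm x ω) :
    N.gauge (fun ω => E ω * D ω) y ≤ N.gauge D x := by
  apply lintegral_mono_ae
  filter_upwards [h] with ω hω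
  refine ENNReal.ofReal_le_ofReal ?_
  rw [div_le_div_iff₀ (mul_pos (hE.pos ω) (hD.pos ω)) (hD.pos ω)]
  calc N.norm y ω * D ω ≤ (E ω * N.norm x ω) * D ω :=
        mul_le_mul_of_nonneg_right hω (hD.pos ω).le
    _ = N.norm x ω * (E ω * D ω) := by ring

variable [IsProbabilityMeasure P]

theorem gauge_le_one (hD : IsWeight D) {z : S} (h : ∀ᵐ ω ∂P, N.norm z ω ≤ D ω) :
    N.gauge D z ≤ 1 := by
  calc N.gauge D z ≤ ∫⁻ _, 1 ∂P := by
        apply lintegral_mono_ae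
        filter_upwards [h] with ω hω
        rw [← ENNReal.ofReal_one]
        exact ENNReal.ofReal_le_ofReal ((div_le_one (hD.pos ω)).mpr hω)
    _ = 1 := by simp

/-- Dominated convergence for the gauge. -/
theorem tendsto_gauge_of_tendsto (hD : IsWeight D) {ι : Type*} {l : Filter ι} {f : ι → S} {z : S}
    (h : Tendsto f l (@nhds S N.topology z))
    (hdom : ∀ᶠ i in l, ∀ᵐ ω ∂P, N.norm (f i - z) ω ≤ D ω) :
    Tendsto (fun i => N.gauge D (f i - z)) l (𝓝 0) := by
  rw [ENNReal.tendsto_nhds_zero]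
  intro δ hδ
  rcases eq_or_ne δ ⊤ with rfl | hδt
  · simp
  have hr : 0 < δ.toReal := ENNReal.toReal_pos hδ.ne' hδt
  set ε := δ.toReal / 2 with hε
  have hε0 : 0 < ε := by positivity
  have h1 := (ENNReal.tendsto_nhds_zero.mp (N.tendsto_iff_measure.mp h ε hε0)) (ENNReal.ofReal ε)
    (ENNReal.ofReal_pos.mpr hε0)
  filter_upwards [h1, hdom] with i hi hd
  have hm : MeasurableSet {ω | ε ≤ N.norm (f i - z) ω} :=
    measurableSet_le measurable_const (N.norm (f i - z)).measurable
  calc N.gauge D (f i - z)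
      ≤ ∫⁻ ω, ENNReal.ofReal ε + {ω | ε ≤ N.norm (f i - z) ω}.indicator 1 ω ∂P := by
        apply lintegral_mono_ae
        filter_upwards [hd, N.ae_norm_nonneg (f i - z)] with ω hω h0
        -- On this event domination bounds the integrand by 1, and the event has small probability;
        -- off it the integrand is at most `ε` because `D ≥ 1`.
        by_cases hc : ε ≤ N.norm (f i - z) ω
        · rw [Set.indicator_of_mem (show ω ∈ {ω | ε ≤ N.norm (f i - z) ω} from hc), Pi.one_apply]
          refine le_add_left ?_
          rw [← ENNReal.ofReal_one]
          exact ENNReal.ofReal_le_ofReal ((div_le_one (hD.pos ω)).mpr hω)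
        · refine le_add_right (ENNReal.ofReal_le_ofReal ?_)
          exact (div_le_self h0 (hD.one_le ω)).trans (not_le.mp hc).le
    _ = ENNReal.ofReal ε + P {ω | ε ≤ N.norm (f i - z) ω} := by
        rw [lintegral_add_left measurable_const, lintegral_indicator_one hm]
        simp
    _ ≤ ENNReal.ofReal ε + ENNReal.ofReal ε := by gcongr
    _ = δ := by
        rw [← ENNReal.ofReal_add hε0.le hε0.le, hε, add_halves, ENNReal.ofReal_toReal hδt]

theorem tendsto_measure_gt_nat (hD : Measurable D) :
    Tendsto (fun n : ℕ => P {ω | (n : ℝ) < D ω}) atTop (𝓝 0) := by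
  have h := tendsto_measure_iInter_atTop (μ := P) (s := fun n : ℕ => {ω | (n : ℝ) < D ω})
    (fun n => (measurableSet_lt measurable_const hD).nullMeasurableSet)
    (fun m n hmn ω (hω : (n : ℝ) < D ω) => lt_of_le_of_lt (Nat.cast_le.mpr hmn) hω)
    ⟨0, measure_ne_top _ _⟩
  have he : ⋂ n : ℕ, {ω | (n : ℝ) < D ω} = ∅ := by
    ext ω
    simp only [Set.mem_iInter, Set.mem_ofPred_eq, Set.mem_empty_iff_false, iff_false, not_forall,
      not_lt]
    exact exists_nat_ge (D ω)
  rwa [he, measure_empty] at h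

/-- Since `D` is finite, {D > n} has small probability for large `n`. On {D ≤ n} the event ‖·‖ ≥ ε
forces ‖·‖ / D ≥ ε / n, which Markov's inequality controls. -/
theorem tendsto_of_tendsto_gauge (hD : IsWeight D) {ι : Type*} {l : Filter ι} {f : ι → S} {z : S}
    (h : Tendsto (fun i => N.gauge D (f i - z)) l (𝓝 0)) :
    Tendsto f l (@nhds S N.topology z) := by
  rw [N.tendsto_iff_measure]
  intro ε hε
  rw [ENNReal.tendsto_nhds_zero]
  intro δ hδ
  have hδ2 : 0 < δ / 2 := ENNReal.half_pos hδ.ne'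
  obtain ⟨n, hn, hn1⟩ := (((ENNReal.tendsto_nhds_zero.mp (tendsto_measure_gt_nat (P := P) hD.measurable))
    (δ / 2) hδ2).and (eventually_ge_atTop 1)).exists
  have hn0 : (0 : ℝ) < n := by exact_mod_cast hn1
  set c : ENNReal := ENNReal.ofReal (ε / n) with hc
  have hc0 : c ≠ 0 := (ENNReal.ofReal_pos.mpr (by positivity)).ne'
  have h2 : Tendsto (fun i => N.gauge D (f i - z) / c) l (𝓝 0) := by
    have := ENNReal.Tendsto.div_const h (b := c) (Or.inr hc0)
    rwa [ENNReal.zero_div] at this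
  filter_upwards [(ENNReal.tendsto_nhds_zero.mp h2) (δ / 2) hδ2] with i hi
  calc P {ω | ε ≤ N.norm (f i - z) ω}
      ≤ P ({ω | c ≤ ENNReal.ofReal (N.norm (f i - z) ω / D ω)} ∪ {ω | (n : ℝ) < D ω}) := by
        apply measure_mono
        intro ω (hω : ε ≤ N.norm (f i - z) ω)
        by_cases hd : (n : ℝ) < D ω
        · exact Or.inr hd
        · left
          refine ENNReal.ofReal_le_ofReal ?_
          exact div_le_div₀ (hε.le.trans hω) hω (hD.pos ω) (not_lt.mp hd)
    _ ≤ N.gauge D (f i - z) / c + δ / 2 :=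
        (measure_union_le _ _).trans (add_le_add (meas_ge_le_lintegral_div
          (N.measurable_gauge hD.measurable _).aemeasurable hc0 ENNReal.ofReal_ne_top) hn)
    _ ≤ δ / 2 + δ / 2 := by gcongr
    _ = δ := ENNReal.add_halves δ

/-- The gauge is lower semicontinuous. -/
theorem gauge_le_of_tendsto (hD : IsWeight D) {f : ℕ → S} {z y : S} {c : ENNReal}
    (h : Tendsto f atTop (@nhds S N.topology z))
    (hc : ∀ᶠ n in atTop, N.gauge D (y - f n) ≤ c) : N.gauge D (y - z) ≤ c := by
  -- Fatou's lemma, applied along an almost surely convergent subsequence.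
  obtain ⟨k, hk, hae⟩ := (N.tendstoInMeasure_of_tendsto h).exists_seq_tendsto_ae'
  have h1 : N.gauge D (y - z) ≤
      ∫⁻ ω, liminf (fun n => ENNReal.ofReal (N.norm (y - f (k n)) ω / D ω)) atTop ∂P := by
    apply lintegral_mono_ae
    have ha : ∀ᵐ ω ∂P, ∀ n, |N.norm (y - f (k n)) ω - N.norm (y - z) ω| ≤ N.norm (f (k n) - z) ω := by
      rw [ae_all_iff]
      intro n
      filter_upwards [N.ae_norm_add_le (y - f (k n)) (f (k n) - z),
        N.ae_norm_sub_le (y - z) (f (k n) - z)] with ω h1 h2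
      rw [sub_add_sub_cancel] at h1
      rw [sub_sub_sub_cancel_right] at h2
      rw [abs_le]
      constructor <;> linarith
    filter_upwards [ha, hae] with ω hω hω'
    have ht : Tendsto (fun n => N.norm (y - f (k n)) ω) atTop (𝓝 (N.norm (y - z) ω)) :=
      tendsto_iff_norm_sub_tendsto_zero.mpr (squeeze_zero (fun _ => _root_.norm_nonneg _) hω hω')
    exact ((ENNReal.continuous_ofReal.tendsto _).comp (ht.div_const (D ω))).liminf_eq.ge
  refine h1.trans ((lintegral_liminf_le' fun n =>
    (N.measurable_gauge hD.measurable _).aemeasurable).trans ?_)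
  exact liminf_le_of_frequently_le' ((hk.eventually hc).frequently)

/-- Along a suitable sequence, convergence in the `(ε, λ)`-topology is convergence for a gauge. -/
theorem exists_weight_frequently_lt {ι : Type*} {l : Filter ι} [l.NeBot] [l.IsCountablyGenerated]
    {f : ι → S} {z : S} (h : Tendsto f l (@nhds S N.topology z)) :
    ∃ D, IsWeight D ∧ ∀ ε : ENNReal, 0 < ε → ∃ᶠ i in l, N.gauge D (f i - z) < ε := by
  obtain ⟨k, hk, hae⟩ := (N.tendstoInMeasure_of_tendsto h).exists_seq_tendsto_ae'
  -- The supremum along an almost surely convergent sequence is almost surely finite, so it serves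
  -- as the dominating weight. Where the sequence is unbounded the real supremum takes the default
  -- value 0; this happens only on a null set.
  have hm : Measurable fun ω => ⨆ n, N.norm (f (k n) - z) ω :=
    Measurable.iSup fun n => (N.norm (f (k n) - z)).measurable
  have hW : IsWeight fun ω => max 1 (⨆ n, N.norm (f (k n) - z) ω) :=
    ⟨measurable_const.max hm, fun ω => le_max_left _ _⟩
  refine ⟨_, hW, fun ε hε => ?_⟩
  have ht : Tendsto (fun n => N.gauge (fun ω => max 1 (⨆ n, N.norm (f (k n) - z) ω)) (f (k n) - z))
      atTop (𝓝 0) := by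
    refine N.tendsto_gauge_of_tendsto hW (f := fun n => f (k n)) (h.comp hk)
      (Eventually.of_forall fun n => ?_)
    filter_upwards [hae] with ω hω
    exact (le_ciSup hω.bddAbove_range n).trans (le_max_right _ _)
  exact hk.frequently ((ht.eventually (gt_mem_nhds hε)).frequently)

end Gauge

end RandomNorm

namespace RandomNorm

variable {Ω : Type*} [MeasurableSpace Ω] {P : Measure Ω} {𝕜 : Type*} [RCLike 𝕜]
  {S : Type*} [AddCommGroup S] [Module (Ω →ₘ[P] 𝕜) S] (N : RandomNorm P 𝕜 S)

/-! ### The Banach space of elements with finite gauge -/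

section GaugeSpace

variable {D : Ω → ℝ}

/-- The elements `z` with `E[‖z‖ / D] < ∞`. -/
def finiteGauge (hD : IsWeight D) : AddSubgroup S where
  carrier := {z | N.gauge D z ≠ ⊤}
  zero_mem' := by
    show N.gauge D 0 ≠ ⊤
    rw [N.gauge_zero]
    exact ENNReal.zero_ne_top
  add_mem' := fun {x y} hx hy =>
    ne_top_of_le_ne_top (ENNReal.add_ne_top.mpr ⟨hx, hy⟩) (N.gauge_add_le hD x y)
  neg_mem' := fun {x} hx => by
    show N.gauge D (-x) ≠ ⊤
    rw [N.gauge_neg]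
    exact hx

variable (hD : IsWeight D)

/-- `E[‖z‖ / D]` as a norm on the elements with finite gauge. -/
noncomputable def gaugeNorm : AddGroupNorm (N.finiteGauge hD) where
  toFun z := (N.gauge D (z : S)).toReal
  map_zero' := by simp [N.gauge_zero]
  add_le' x y := by
    rw [← ENNReal.toReal_add x.2 y.2]
    exact ENNReal.toReal_mono (ENNReal.add_ne_top.mpr ⟨x.2, y.2⟩) (N.gauge_add_le hD x y)
  neg' x := by simp [N.gauge_neg]
  eq_zero_of_map_eq_zero' x hx := by
    rcases (ENNReal.toReal_eq_zero_iff _).mp hx with h | h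
    · exact Subtype.ext (N.eq_zero_of_gauge_eq_zero hD h)
    · exact absurd h x.2

noncomputable instance : NormedAddCommGroup (N.finiteGauge hD) :=
  (N.gaugeNorm hD).toNormedAddCommGroup

theorem norm_finiteGauge (z : N.finiteGauge hD) : ‖z‖ = (N.gauge D (z : S)).toReal := rfl

noncomputable instance : Module ℝ (N.finiteGauge hD) where
  smul c z := ⟨rsmul P 𝕜 c (z : S), by
    show N.gauge D _ ≠ ⊤
    rw [N.gauge_rsmul]
    exact ENNReal.mul_ne_top ENNReal.ofReal_ne_top z.2⟩
  one_smul z := Subtype.ext (one_rsmul _)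
  mul_smul c d z := Subtype.ext (mul_rsmul _ _ _)
  smul_zero c := Subtype.ext (rsmul_zero _)
  smul_add c x y := Subtype.ext (rsmul_add _ _ _)
  add_smul c d x := Subtype.ext (add_rsmul _ _ _)
  zero_smul x := Subtype.ext (zero_rsmul _)

theorem coe_smul_finiteGauge (c : ℝ) (z : N.finiteGauge hD) :
    ((c • z : N.finiteGauge hD) : S) = rsmul P 𝕜 c (z : S) := rfl

noncomputable instance : NormedSpace ℝ (N.finiteGauge hD) where
  norm_smul_le c z := by
    rw [norm_finiteGauge, coe_smul_finiteGauge, N.gauge_rsmul, ENNReal.toReal_mul,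
      ENNReal.toReal_ofReal (abs_nonneg c)]
    rfl

variable [IsProbabilityMeasure P]

/-- By Markov's inequality a gauge-Cauchy sequence is Cauchy for the (ε, λ)-uniformity, so
completeness of `S` supplies a limit. -/
theorem exists_tendsto_of_cauchy_gauge {D : Ω → ℝ} (hD : IsWeight D) (hN : N.IsComplete) {u : ℕ → S}
    (hu : ∀ ε : ENNReal, 0 < ε → ∃ n, ∀ i ≥ n, ∀ j ≥ n, N.gauge D (u j - u i) ≤ ε) :
    ∃ z, Tendsto u atTop (@nhds S N.topology z) := by
  let _ := N.uniformSpace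
  have : CompleteSpace S := hN
  refine cauchySeq_tendsto_of_complete ?_
  rw [cauchySeq_iff_tendsto]
  -- The uniformity is the pullback of the neighbourhoods of 0 under subtraction, so the Cauchy
  -- condition becomes convergence of differences to 0.
  change Tendsto _ atTop (comap (fun p : S × S => p.2 + -p.1) (@nhds S N.topology 0))
  rw [tendsto_comap_iff]
  apply N.tendsto_of_tendsto_gauge hD
  rw [ENNReal.tendsto_nhds_zero]
  intro ε hε
  obtain ⟨n, hn⟩ := hu ε hε
  filter_upwards [eventually_ge_atTop (n, n)] with p hp
  simpa [sub_eq_add_neg] using hn p.1 hp.1 p.2 hp.2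

theorem completeSpace_finiteGauge (hN : N.IsComplete) : CompleteSpace (N.finiteGauge hD) := by
  have hle : ∀ (x y : N.finiteGauge hD) (ε : ℝ), dist x y < ε →
      N.gauge D ((x : S) - y) ≤ ENNReal.ofReal ε := by
    intro x y ε h
    rw [dist_eq_norm, norm_finiteGauge] at h
    exact ((ENNReal.lt_ofReal_iff_toReal_lt (x - y).2).mpr h).le
  refine Metric.complete_of_cauchySeq_tendsto fun u hu => ?_
  obtain ⟨z, hz⟩ := N.exists_tendsto_of_cauchy_gauge hD hN (u := fun n => (u n : S)) (by
    intro ε hε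
    rcases eq_or_ne ε ⊤ with rfl | hεt
    · exact ⟨0, fun _ _ _ _ => le_top⟩
    obtain ⟨n, hn⟩ := Metric.cauchySeq_iff.mp hu ε.toReal (ENNReal.toReal_pos hε.ne' hεt)
    refine ⟨n, fun i hi j hj => ?_⟩
    rw [← ENNReal.ofReal_toReal hεt]
    exact hle _ _ _ (hn j hj i hi))
  -- Lower semicontinuity of the gauge upgrades the limit in probability to a limit in the gauge.
  have hlim : ∀ ε : ℝ, 0 < ε → ∀ᶠ n in atTop, N.gauge D ((u n : S) - z) ≤ ENNReal.ofReal ε := by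
    intro ε hε
    obtain ⟨n, hn⟩ := Metric.cauchySeq_iff.mp hu ε hε
    filter_upwards [eventually_ge_atTop n] with i hi
    refine N.gauge_le_of_tendsto hD hz ?_
    filter_upwards [eventually_ge_atTop n] with j hj
    exact hle _ _ _ (hn i hi j hj)
  have hzt : N.gauge D z ≠ ⊤ := by
    obtain ⟨n, hn⟩ := (hlim 1 one_pos).exists
    refine ne_top_of_le_ne_top (ENNReal.add_ne_top.mpr ⟨ENNReal.ofReal_ne_top (r := 1), (u n).2⟩)
      ((N.gauge_le_sub_add hD z (u n)).trans (add_le_add_left ?_ _))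
    rw [N.gauge_sub_rev]
    exact hn
  refine ⟨⟨z, hzt⟩, Metric.tendsto_nhds.mpr fun ε hε => ?_⟩
  filter_upwards [hlim (ε / 2) (half_pos hε)] with n hn
  rw [dist_eq_norm, norm_finiteGauge]
  have h1 := ENNReal.toReal_mono ENNReal.ofReal_ne_top hn
  rw [ENNReal.toReal_ofReal (half_pos hε).le] at h1
  exact h1.trans_lt (half_lt_self hε)

end GaugeSpace

/-! ### Primitives -/

/-- `p` is a primitive of `f` with respect to the gauge `E[‖·‖ / D]`, with `p 0 = 0`. -/
structure IsPrimitive (D : Ω → ℝ) (f p : ℝ → S) : Prop where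
  zero : p 0 = 0
  gauge_ne_top : ∀ t, N.gauge D (p t) ≠ ⊤
  deriv : ∀ t ε : ℝ, 0 < ε → ∀ᶠ h in 𝓝 (0 : ℝ),
    N.gauge D (p (t + h) - p t - rsmul P 𝕜 h (f t)) ≤ ENNReal.ofReal (ε * |h|)

/-- The hypotheses make `f` a continuous curve in the Banach space of finite gauge, so its Bochner
integral from 0 exists and the fundamental theorem of calculus applies. -/
theorem exists_isPrimitive [IsProbabilityMeasure P] (hN : N.IsComplete) {D : Ω → ℝ}
    (hD : IsWeight D) {f : ℝ → S} (hf : ∀ t, N.gauge D (f t) ≠ ⊤)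
    (hc : ∀ t, Tendsto (fun r => N.gauge D (f r - f t)) (𝓝 t) (𝓝 0)) :
    ∃ p, N.IsPrimitive D f p := by
  have := N.completeSpace_finiteGauge hD hN
  let g : ℝ → N.finiteGauge hD := fun t => ⟨f t, hf t⟩
  have hg : Continuous g := by
    rw [continuous_iff_continuousAt]
    intro t
    rw [ContinuousAt, tendsto_iff_norm_sub_tendsto_zero]
    have := (ENNReal.tendsto_toReal ENNReal.zero_ne_top).comp (hc t)
    exact this
  refine ⟨fun t => ((∫ r in (0 : ℝ)..t, g r : N.finiteGauge hD) : S), ?_, fun t => ?_,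
    fun t ε hε => ?_⟩
  · simp
  · exact (∫ r in (0 : ℝ)..t, g r : N.finiteGauge hD).2
  · have h1 := intervalIntegral.integral_hasDerivAt_right (hg.intervalIntegrable 0 t)
      hg.stronglyMeasurable.stronglyMeasurableAtFilter hg.continuousAt
    rw [hasDerivAt_iff_isLittleO_nhds_zero] at h1
    filter_upwards [h1.def hε] with h hh
    rw [norm_finiteGauge, Real.norm_eq_abs] at hh
    exact (ENNReal.le_ofReal_iff_toReal_le ((∫ r in (0 : ℝ)..t + h, g r) - (∫ r in (0 : ℝ)..t, g r) - h • g t :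
      N.finiteGauge hD).2
      (mul_nonneg hε.le (abs_nonneg h))).mpr hh

variable {N}

theorem IsPrimitive.tendsto {D : Ω → ℝ} (hD : IsWeight D) {f p : ℝ → S} (hp : N.IsPrimitive D f p)
    {t : ℝ} (hf : N.gauge D (f t) ≠ ⊤) :
    Tendsto (fun r => N.gauge D (p r - p t)) (𝓝 t) (𝓝 0) := by
  have h1 : Tendsto (fun r => r - t) (𝓝 t) (𝓝 0) := by
    have : Tendsto (fun r => r - t) (𝓝 t) (𝓝 (t - t)) := (continuous_id.sub continuous_const).tendsto t
    rwa [sub_self] at this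
  have h2 := h1.eventually (hp.deriv t 1 one_pos)
  have h3 : Tendsto (fun r => ENNReal.ofReal |r - t| + ENNReal.ofReal |r - t| * N.gauge D (f t))
      (𝓝 t) (𝓝 0) := by
    have h4 : Tendsto (fun r => ENNReal.ofReal |r - t|) (𝓝 t) (𝓝 0) := by
      rw [← ENNReal.ofReal_zero, ← abs_zero]
      exact (ENNReal.continuous_ofReal.comp continuous_abs).continuousAt.tendsto.comp h1
    have h5 := h4.add (ENNReal.Tendsto.mul_const h4 (Or.inr hf))
    rwa [zero_mul, add_zero] at h5
  refine tendsto_of_tendsto_of_tendsto_of_le_of_le' tendsto_const_nhds h3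
    (Eventually.of_forall fun _ => zero_le) ?_
  filter_upwards [h2] with r hr
  rw [add_sub_cancel, one_mul] at hr
  rw [← N.gauge_rsmul]
  exact (N.gauge_le_sub_add hD _ _).trans (add_le_add_left hr _)

/-! ### A mean value inequality for the gauge -/

variable (N) in
/-- A curve with vanishing lower right derivative with respect to a gauge is constant. -/
theorem eq_zero_of_frequently_gauge_sub_le {D : Ω → ℝ} (hD : IsWeight D) {p : ℝ → S} {L : ℝ}
    (h0 : p 0 = 0) (hfin : ∀ t ∈ Set.Icc 0 L, N.gauge D (p t) ≠ ⊤)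
    (hc : ∀ t ∈ Set.Icc 0 L, Tendsto (fun r => N.gauge D (p r - p t)) (𝓝[Set.Icc 0 L] t) (𝓝 0))
    (hd : ∀ t ∈ Set.Ico 0 L, ∀ ε : ℝ, 0 < ε → ∃ᶠ h in 𝓝[>] (0 : ℝ),
      t + h ≤ L ∧ N.gauge D (p (t + h) - p t) ≤ ENNReal.ofReal (ε * h))
    {t : ℝ} (ht : t ∈ Set.Icc 0 L) : p t = 0 := by
  set g : ℝ → ℝ := fun t => (N.gauge D (p t)).toReal with hg
  have hsub : ∀ r ∈ Set.Icc 0 L, ∀ t ∈ Set.Icc 0 L, ∀ c : ENNReal, c ≠ ⊤ →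
      N.gauge D (p r - p t) ≤ c → g r - g t ≤ c.toReal := by
    intro r hr t ht c hct hcle
    have h1 := (N.gauge_le_sub_add hD (p r) (p t)).trans (add_le_add_left hcle _)
    have h2 := ENNReal.toReal_mono (ENNReal.add_ne_top.mpr ⟨hct, hfin t ht⟩) h1
    rw [ENNReal.toReal_add hct (hfin t ht)] at h2
    linarith
  have hcont : ContinuousOn g (Set.Icc 0 L) := by
    intro t ht
    rw [ContinuousWithinAt, tendsto_iff_norm_sub_tendsto_zero]
    have h1 := (ENNReal.tendsto_toReal ENNReal.zero_ne_top).comp (hc t ht)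
    rw [ENNReal.toReal_zero] at h1
    refine squeeze_zero' (Eventually.of_forall fun _ => _root_.norm_nonneg _) ?_ h1
    filter_upwards [self_mem_nhdsWithin] with r hr
    have hfin' : N.gauge D (p r - p t) ≠ ⊤ := ne_top_of_le_ne_top
      (ENNReal.add_ne_top.mpr ⟨hfin r hr, hfin t ht⟩) (N.gauge_sub_le hD _ _)
    rw [Real.norm_eq_abs, abs_le]
    constructor
    · have := hsub t ht r hr _ hfin' (N.gauge_sub_rev _ _).le
      simp only [Function.comp_apply]
      linarith
    · exact hsub r hr t ht _ hfin' le_rfl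
  -- The gauge of an increment of `p` bounds the increment of the real function `g`, so `g` has
  -- lower right derivative at most 0 and stays below the constant 0.
  have key := image_le_of_liminf_slope_right_le_deriv_boundary hcont (B := fun _ => 0)
    (B' := fun _ => 0) (by simp [hg, h0, N.gauge_zero]) continuousOn_const
    (fun x _ => hasDerivWithinAt_const x _ 0) (by
      intro x hx r hr
      have hmap : Tendsto (fun h => x + h) (𝓝[>] (0 : ℝ)) (𝓝[>] x) := by
        refine tendsto_nhdsWithin_iff.mpr ⟨?_, ?_⟩
        · have : Tendsto (fun h => x + h) (𝓝 0) (𝓝 (x + 0)) :=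
            (continuous_const.add continuous_id).tendsto 0
          rw [add_zero] at this
          exact this.mono_left nhdsWithin_le_nhds
        · filter_upwards [self_mem_nhdsWithin] with h hh
          exact lt_add_of_pos_right x hh
      refine hmap.frequently (((hd x hx (r / 2) (half_pos hr)).and_eventually
        self_mem_nhdsWithin).mono ?_)
      rintro h ⟨⟨hL, hle⟩, hh⟩
      have hh' : 0 < h := hh
      have h1 := hsub (x + h) ⟨by linarith [hx.1], hL⟩ x ⟨hx.1, hx.2.le⟩ _ ENNReal.ofReal_ne_top hle
      rw [ENNReal.toReal_ofReal (by positivity)] at h1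
      rw [slope_def_field, add_sub_cancel_left, div_lt_iff₀ hh']
      nlinarith) ht
  have h1 : g t = 0 := le_antisymm key ENNReal.toReal_nonneg
  rcases (ENNReal.toReal_eq_zero_iff _).mp h1 with h | h
  · exact N.eq_zero_of_gauge_eq_zero hD h
  · exact absurd h (hfin t ht)

end RandomNorm

namespace RandomNorm

variable {Ω : Type*} [MeasurableSpace Ω] {P : Measure Ω} {𝕜 : Type*} [RCLike 𝕜]
  {S : Type*} [AddCommGroup S] [Module (Ω →ₘ[P] 𝕜) S] {N : RandomNorm P 𝕜 S}

theorem IsPrimitive.sub {D : Ω → ℝ} (hD : IsWeight D) {f g p q : ℝ → S}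
    (hp : N.IsPrimitive D f p) (hq : N.IsPrimitive D g q) :
    N.IsPrimitive D (fun t => f t - g t) (fun t => p t - q t) where
  zero := by simp [hp.zero, hq.zero]
  gauge_ne_top t := ne_top_of_le_ne_top
    (ENNReal.add_ne_top.mpr ⟨hp.gauge_ne_top t, hq.gauge_ne_top t⟩) (N.gauge_sub_le hD _ _)
  deriv t ε hε := by
    filter_upwards [hp.deriv t (ε / 2) (half_pos hε), hq.deriv t (ε / 2) (half_pos hε)] with h h1 h2
    have e : p (t + h) - q (t + h) - (p t - q t) - rsmul P 𝕜 h (f t - g t) =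
        (p (t + h) - p t - rsmul P 𝕜 h (f t)) - (q (t + h) - q t - rsmul P 𝕜 h (g t)) := by
      rw [rsmul_sub]; abel
    have e' : ε * |h| = ε / 2 * |h| + ε / 2 * |h| := by ring
    rw [e, e', ENNReal.ofReal_add (by positivity) (by positivity)]
    exact (N.gauge_sub_le hD _ _).trans (add_le_add h1 h2)

/-! ### Almost surely bounded operators -/

namespace BoundedOp

theorem map_add (T : N.BoundedOp) (x y : S) : T (x + y) = T x + T y := T.map_add' x y

theorem map_zero (T : N.BoundedOp) : T 0 = 0 := by
  have h := T.map_add 0 0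
  rwa [add_zero, left_eq_add] at h

theorem map_neg (T : N.BoundedOp) (x : S) : T (-x) = -T x := by
  rw [eq_neg_iff_add_eq_zero, ← T.map_add, neg_add_cancel, T.map_zero]

theorem map_sub (T : N.BoundedOp) (x y : S) : T (x - y) = T x - T y := by
  rw [sub_eq_add_neg, T.map_add, T.map_neg, sub_eq_add_neg]

theorem map_rsmul (T : N.BoundedOp) (c : ℝ) (x : S) :
    T (rsmul P 𝕜 c x) = rsmul P 𝕜 c (T x) := T.map_smul' _ x

/-- The infimum of the almost sure bounds is attained, hence is itself a bound. -/
theorem norm_le_opNorm_mul [IsProbabilityMeasure P] (T : N.BoundedOp) (x : S) :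
    N.norm (T x) ≤ T.opNorm * N.norm x := by
  obtain ⟨η, hη⟩ := T.exists_isLeast_bounds
  rw [T.isGLB_opNorm.unique hη.isGLB]
  exact hη.1.2 x

end BoundedOp

/-- `E` bounds the operators `W(s)`, `0 ≤ s ≤ L`. -/
def BoundsOn (N : RandomNorm P 𝕜 S) (E : Ω → ℝ) (W : ℝ≥0 → N.BoundedOp) (L : ℝ≥0) : Prop :=
  ∀ s ≤ L, ∀ x, ∀ᵐ ω ∂P, N.norm (W s x) ω ≤ E ω * N.norm x ω

theorem BoundsOn.mono {E E' : Ω → ℝ} {W : ℝ≥0 → N.BoundedOp} {L : ℝ≥0} (h : N.BoundsOn E W L)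
    (hE : ∀ ω, E ω ≤ E' ω) : N.BoundsOn E' W L := by
  intro s hs x
  filter_upwards [h s hs x, N.ae_norm_nonneg x] with ω h1 h2
  exact h1.trans (mul_le_mul_of_nonneg_right (hE ω) h2)

theorem BoundsOn.gauge_map_le {D E : Ω → ℝ} {W : ℝ≥0 → N.BoundedOp} {L : ℝ≥0}
    (h : N.BoundsOn E W L) (hD : IsWeight D) (hE : IsWeight E) {s : ℝ≥0} (hs : s ≤ L) (x : S) :
    N.gauge (fun ω => E ω * D ω) (W s x) ≤ N.gauge D x :=
  N.gauge_map_le hD hE (h s hs x)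

theorem gauge_mul_le {D E : Ω → ℝ} (hD : IsWeight D) (hE : IsWeight E) (x : S) :
    N.gauge (fun ω => E ω * D ω) x ≤ N.gauge D x :=
  N.gauge_anti hD (fun ω => le_mul_of_one_le_left (hD.pos ω).le (hE.one_le ω)) x

variable [IsProbabilityMeasure P]

theorem LocallyASBounded.exists_boundsOn {W : ℝ≥0 → N.BoundedOp} (hW : N.LocallyASBounded W)
    {L : ℝ≥0} (hL : 0 < L) : ∃ E : Ω → ℝ, Measurable E ∧ N.BoundsOn E W L := by
  obtain ⟨M, -, hM⟩ := hW L hL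
  refine ⟨M, M.measurable, fun s hs x => ?_⟩
  filter_upwards [AEEqFun.coeFn_le.mpr ((W s).norm_le_opNorm_mul x),
    AEEqFun.coeFn_mul (W s).opNorm (N.norm x),
    AEEqFun.coeFn_le.mpr (hM.1 ⟨s, ⟨zero_le, hs⟩, rfl⟩), N.ae_norm_nonneg x] with ω h1 h2 h3 h4
  rw [h2] at h1
  exact h1.trans (mul_le_mul_of_nonneg_right h3 h4)

/-- The time `r` clamped to `[0, L]`. -/
noncomputable def clamp (L : ℝ≥0) (r : ℝ) : ℝ≥0 := min r.toNNReal L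

theorem continuous_clamp (L : ℝ≥0) : Continuous (clamp L) :=
  continuous_real_toNNReal.min continuous_const

theorem clamp_le (L : ℝ≥0) (r : ℝ) : clamp L r ≤ L := min_le_right _ _

theorem clamp_coe {L a : ℝ≥0} (h : a ≤ L) : clamp L a = a := by
  rw [clamp, Real.toNNReal_coe, min_eq_left h]

theorem clamp_zero (L : ℝ≥0) : clamp L 0 = 0 := by simp [clamp]

/-! ### Orbits, generators and primitives of a C-semigroup -/

section Semigroup

variable {C : N.BoundedOp} {W : ℝ≥0 → N.BoundedOp} {L : ℝ≥0} {D E : Ω → ℝ}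

theorem IsCSemigroup.zero_apply (hW : N.IsCSemigroup C W) (x : S) : W 0 x = C x := by
  rw [hW.zero]

theorem IsCSemigroup.comm_generator (hW : N.IsCSemigroup C W) (t : ℝ≥0) (x : S) :
    W t (C x) = C (W t x) := by
  have h := hW.comp 0 t x
  rw [zero_add, hW.zero_apply] at h
  exact h.symm

theorem IsCSemigroup.comm (hW : N.IsCSemigroup C W) (s t : ℝ≥0) (x : S) :
    W t (W s x) = W s (W t x) := by
  rw [← hW.comp, add_comm, hW.comp]

/-- Dominated convergence: two points of the orbit differ by at most 2E‖x‖, hence the factor 2.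
Clamping extends the orbit continuously to the whole line, so its primitives are differentiable from
both sides even at the ends of [0, L]. -/
theorem IsCSemigroup.tendsto_gauge (hW : N.IsCSemigroup C W) (hb : N.BoundsOn E W L)
    (hD : IsWeight D) {x : S} (hx : ∀ᵐ ω ∂P, 2 * (E ω * N.norm x ω) ≤ D ω) (t : ℝ) :
    Tendsto (fun r => N.gauge D (W (clamp L r) x - W (clamp L t) x)) (𝓝 t) (𝓝 0) := by
  refine N.tendsto_gauge_of_tendsto hD (f := fun r => W (clamp L r) x) ?_
    (Eventually.of_forall fun r => ?_)
  · let _ := N.topology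
    exact ((hW.strongly_continuous x).comp (continuous_clamp L)).tendsto t
  · filter_upwards [hx, hb _ (clamp_le L r) x, hb _ (clamp_le L t) x,
      N.ae_norm_sub_le (W (clamp L r) x) (W (clamp L t) x)] with ω h1 h2 h3 h4
    linarith

theorem HasDerivAtZero.sub {x y x' y' : S} (h : N.HasDerivAtZero C W x y)
    (h' : N.HasDerivAtZero C W x' y') : N.HasDerivAtZero C W (x - x') (y - y') := by
  let _ := N.topology
  have := N.basis.isTopologicalAddGroup
  refine (Tendsto.sub h h').congr fun s => ?_
  rw [← smul_sub, (W s).map_sub, C.map_sub]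
  congr 1
  abel

/-- The two limits differ by a limit of the zero curve, so some gauge of their difference is smaller
than every positive number. -/
theorem HasDerivAtZero.unique {x y y' : S} (h : N.HasDerivAtZero C W x y)
    (h' : N.HasDerivAtZero C W x y') : y = y' := by
  let _ := N.topology
  have := N.basis.isTopologicalAddGroup
  have h0 := Tendsto.sub h h'
  obtain ⟨D, hD, hlt⟩ := N.exists_weight_frequently_lt h0
  have h1 : N.gauge D (y' - y) = 0 := by
    by_contra hne
    obtain ⟨i, hi⟩ := (hlt _ (pos_iff_ne_zero.mpr hne)).exists
    rw [sub_self, zero_sub, neg_sub] at hi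
    exact lt_irrefl _ hi
  exact (sub_eq_zero.mp (N.eq_zero_of_gauge_eq_zero hD h1)).symm

/-- Uniqueness of limits and injectivity of `C` make the chosen preimage the only one. -/
theorem mem_generator_iff (hW : N.IsCSemigroup C W) {x y : S} :
    y ∈ N.generator C W x ↔ N.HasDerivAtZero C W x (C y) := by
  constructor
  · rintro ⟨h, rfl⟩
    exact Classical.choose_spec h
  · intro h
    have hd : ∃ y, N.HasDerivAtZero C W x (C y) := ⟨y, h⟩
    exact ⟨hd, hW.injective ((Classical.choose_spec hd).unique h)⟩

theorem tendsto_coe_nhdsGT_zero : Tendsto ((↑) : ℝ≥0 → ℝ) (𝓝[>] 0) (𝓝[>] 0) := by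
  refine tendsto_nhdsWithin_iff.mpr ⟨?_, ?_⟩
  · exact (NNReal.continuous_coe.tendsto 0).mono_left nhdsWithin_le_nhds
  · filter_upwards [self_mem_nhdsWithin] with s hs
    exact NNReal.coe_pos.mpr hs

/-- The integrated form of differentiability: `W(t)y = Cy + ∫₀ᵗ W(r)z dr` when `z` is the value of
the generator at `y`. -/
theorem IsCSemigroup.eq_add_primitive (hW : N.IsCSemigroup C W) (hE : IsWeight E)
    (hb : N.BoundsOn E W L) (hD : IsWeight D) {y z : S} (hyz : N.HasDerivAtZero C W y (C z))
    {R : ℝ → S} (hR : N.IsPrimitive D (fun r => W (clamp L r) z) R)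
    (hfin : ∀ r, N.gauge D (W (clamp L r) z) ≠ ⊤) {t : ℝ≥0} (ht : t ≤ L) :
    W t y = C y + R t := by
  obtain ⟨Q, hQ, hlt⟩ := N.exists_weight_frequently_lt hyz
  -- One weight for three purposes: `D` controls the primitive, `Q` the difference quotient of `y`
  -- at 0, and the last entry dominates the orbit of `y`.
  set G : Ω → ℝ := fun ω => max (max (D ω) (Q ω)) (2 * (E ω * N.norm y ω)) with hG
  have hGw : IsWeight G := (hD.max hQ.measurable).max
    (measurable_const.mul (hE.measurable.mul (N.norm y).measurable))
  have hDG : ∀ ω, D ω ≤ G ω := fun ω => (le_max_left _ _).trans (le_max_left _ _)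
  have hQG : ∀ ω, Q ω ≤ G ω := fun ω => (le_max_right _ _).trans (le_max_left _ _)
  have hyG : ∀ᵐ ω ∂P, 2 * (E ω * N.norm y ω) ≤ G ω := Eventually.of_forall fun ω => le_max_right _ _
  have hCle : ∀ u, N.gauge (fun ω => E ω * G ω) (C u) ≤ N.gauge G u := fun u => by
    rw [← hW.zero_apply]
    exact hb.gauge_map_le hGw hE zero_le u
  -- The semigroup law splits W(r+s) only after `C` is applied; the extra `C` is removed at the end
  -- by injectivity.
  set p : ℝ → S := fun r => C (W (clamp L r) y - C y - R r) with hp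
  have key : p t = 0 := by
    refine N.eq_zero_of_frequently_gauge_sub_le (hE.mul hGw) (L := L) ?_ (fun r _ => ?_)
      (fun r _ => ?_) (fun r hr ε hε => ?_) ⟨t.2, NNReal.coe_le_coe.mpr ht⟩
    · simp only [hp, clamp_zero, hW.zero_apply, hR.zero, sub_self, C.map_zero]
    · refine ne_top_of_le_ne_top (ENNReal.add_ne_top.mpr
        ⟨ENNReal.one_ne_top, hR.gauge_ne_top r⟩) ((hCle _).trans ((N.gauge_sub_le hGw _ _).trans
        (add_le_add (N.gauge_le_one hGw ?_) (N.gauge_anti hD hDG _))))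
      filter_upwards [hyG, hb _ (clamp_le L r) y, hb 0 zero_le y,
        N.ae_norm_sub_le (W (clamp L r) y) (C y)] with ω h1 h2 h3 h4
      rw [hW.zero_apply] at h3
      linarith
    · have h1 := (hW.tendsto_gauge hb hGw hyG r).add (hR.tendsto hD (hfin r))
      rw [add_zero] at h1
      refine tendsto_of_tendsto_of_tendsto_of_le_of_le tendsto_const_nhds
        (h1.mono_left nhdsWithin_le_nhds) (fun _ => zero_le) fun q => ?_
      have e : p q - p r = C ((W (clamp L q) y - W (clamp L r) y) - (R q - R r)) := by
        rw [hp, ← C.map_sub]; congr 1; abel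
      show N.gauge _ (p q - p r) ≤ _
      rw [e]
      exact (hCle _).trans ((N.gauge_sub_le hGw _ _).trans
        (add_le_add le_rfl (N.gauge_anti hD hDG _)))
    · lift r to ℝ≥0 using hr.1
      have hrL : r < L := NNReal.coe_lt_coe.mp hr.2
      have h1 := hlt (ENNReal.ofReal (ε / 2)) (ENNReal.ofReal_pos.mpr (half_pos hε))
      have h2 : ∀ᶠ s : ℝ≥0 in 𝓝[>] 0, N.gauge D (R (r + s) - R r - rsmul P 𝕜 s (W (clamp L r) z)) ≤
          ENNReal.ofReal (ε / 2 * |(s : ℝ)|) :=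
        (tendsto_coe_nhdsGT_zero.mono_right nhdsWithin_le_nhds).eventually
          (hR.deriv r (ε / 2) (half_pos hε))
      have h3 : ∀ᶠ s : ℝ≥0 in 𝓝[>] 0, s < L - r :=
        nhdsWithin_le_nhds (gt_mem_nhds (tsub_pos_of_lt hrL))
      refine tendsto_coe_nhdsGT_zero.frequently
        ((h1.and_eventually (h2.and (h3.and self_mem_nhdsWithin))).mono ?_)
      rintro s ⟨hs1, hs2, hs3, hs0⟩
      have hs0' : (0 : ℝ) < s := NNReal.coe_pos.mpr hs0
      have hrs : r + s ≤ L := (lt_tsub_iff_left.mp hs3).le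
      refine ⟨by exact_mod_cast hrs, ?_⟩
      rw [clamp_coe hrL.le] at hs2
      set d := rsmul P 𝕜 ((s : ℝ)⁻¹) (W s y - C y) - C z with hd
      have hd' : rsmul P 𝕜 s d = W s y - C y - rsmul P 𝕜 s (C z) := by
        rw [hd, rsmul_sub, ← mul_rsmul, mul_inv_cancel₀ hs0'.ne', one_rsmul]
      -- Since CW(r+s)y - CW(r)y = W(r)(W(s)y - Cy), the quotient at time 0 governs the increment at
      -- time `r`. The two main terms sCW(r)z cancel.
      have e : p (r + s) - p r = W r (rsmul P 𝕜 s d) -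
          C (R (r + s) - R r - rsmul P 𝕜 s (W r z)) := by
        have hcl : clamp L ((r : ℝ) + s) = r + s := by
          rw [← NNReal.coe_add, clamp_coe hrs]
        simp only [hp, hcl, clamp_coe hrL.le, hd', C.map_sub, (W r).map_sub, (W r).map_rsmul,
          hW.comm_generator, C.map_rsmul, hW.comp]
        rw [hW.comm]
        abel
      have h4 : N.gauge Q d ≤ ENNReal.ofReal (ε / 2) := hs1.le
      rw [e]
      calc _ ≤ N.gauge G (rsmul P 𝕜 s d) + N.gauge G (R (r + s) - R r - rsmul P 𝕜 s (W r z)) :=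
            (N.gauge_sub_le (hE.mul hGw) _ _).trans
              (add_le_add (hb.gauge_map_le hGw hE hrL.le _) (hCle _))
        _ ≤ ENNReal.ofReal |(s : ℝ)| * ENNReal.ofReal (ε / 2) + ENNReal.ofReal (ε / 2 * |(s : ℝ)|) := by
            refine add_le_add ?_ ((N.gauge_anti hD hDG _).trans hs2)
            rw [N.gauge_rsmul]
            exact mul_le_mul_right ((N.gauge_anti hQ hQG _).trans h4) _
        _ = ENNReal.ofReal (ε * s) := by
            rw [← ENNReal.ofReal_mul (abs_nonneg _), ← ENNReal.ofReal_add (by positivity)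
              (by positivity), abs_of_pos hs0']
            congr 1
            ring
  have h := hW.injective (key.trans C.map_zero.symm)
  rw [clamp_coe ht, sub_sub, sub_eq_zero] at h
  exact h

/-- `W(h) ∫₀ᵃ W(r)x dr = C ∫ₕᵃ⁺ʰ W(r)x dr`. -/
theorem IsCSemigroup.apply_primitive (hW : N.IsCSemigroup C W) (hE : IsWeight E)
    (hb : N.BoundsOn E W L) (hD : IsWeight D) {x : S} {R : ℝ → S}
    (hR : N.IsPrimitive D (fun r => W (clamp L r) x) R)
    (hfin : ∀ r, N.gauge D (W (clamp L r) x) ≠ ⊤) {a h : ℝ≥0} (hah : a + h ≤ L) :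
    W h (R a) = C (R (a + h) - R h) := by
  have hhL : h ≤ L := le_add_self.trans hah
  have hCle : ∀ u, N.gauge (fun ω => E ω * D ω) (C u) ≤ N.gauge D u := fun u => by
    rw [← hW.zero_apply]
    exact hb.gauge_map_le hD hE zero_le u
  -- Both terms have the same derivative, as W(h)W(r)x = CW(r+h)x, and both vanish at 0.
  set p : ℝ → S := fun r => W h (R r) - C (R (r + h) - R h) with hp
  have hsub : ∀ q r, N.gauge (fun ω => E ω * D ω) (p q - p r) ≤
      N.gauge D (R q - R r) + N.gauge D (R (q + h) - R (r + h)) := by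
    intro q r
    have e : p q - p r = W h (R q - R r) - C (R (q + h) - R (r + h)) := by
      simp only [hp, C.map_sub, (W h).map_sub]; abel
    rw [e]
    exact (N.gauge_sub_le (hE.mul hD) _ _).trans (add_le_add (hb.gauge_map_le hD hE hhL _) (hCle _))
  have h0 : p 0 = 0 := by
    simp only [hp, hR.zero, (W h).map_zero, zero_add, sub_self, C.map_zero]
  have key : p a = 0 := by
    refine N.eq_zero_of_frequently_gauge_sub_le (hE.mul hD) (L := (L : ℝ) - h) h0 (fun r _ => ?_)
      (fun r _ => ?_) (fun r hr ε hε => ?_) ⟨a.2, le_sub_iff_add_le.mpr (by exact_mod_cast hah)⟩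
    · have h1 := hsub r 0
      rw [h0, sub_zero, hR.zero, sub_zero, zero_add] at h1
      exact ne_top_of_le_ne_top (ENNReal.add_ne_top.mpr ⟨hR.gauge_ne_top r, ne_top_of_le_ne_top
        (ENNReal.add_ne_top.mpr ⟨hR.gauge_ne_top _, hR.gauge_ne_top _⟩) (N.gauge_sub_le hD _ _)⟩) h1
    · have hm : Tendsto (fun q : ℝ => q + h) (𝓝 r) (𝓝 (r + h)) :=
        (continuous_id.add continuous_const).tendsto r
      have h1 := (hR.tendsto hD (hfin r)).add ((hR.tendsto hD (hfin (r + h))).comp hm)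
      rw [add_zero] at h1
      exact tendsto_of_tendsto_of_tendsto_of_le_of_le tendsto_const_nhds
        (h1.mono_left nhdsWithin_le_nhds) (fun _ => zero_le) fun q => hsub q r
    · lift r to ℝ≥0 using hr.1
      have hrh : r + h ≤ L := by
        have := hr.2
        rw [← NNReal.coe_le_coe, NNReal.coe_add]
        linarith
      refine Eventually.frequently ?_
      filter_upwards [nhdsWithin_le_nhds (hR.deriv r (ε / 2) (half_pos hε)),
        nhdsWithin_le_nhds (hR.deriv (r + h) (ε / 2) (half_pos hε)), self_mem_nhdsWithin,
        nhdsWithin_le_nhds (gt_mem_nhds (show (0 : ℝ) < L - h - r by linarith [hr.2]))]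
        with k h1 h2 hk hk'
      have hk0 : 0 < k := hk
      refine ⟨by linarith, ?_⟩
      have hcl : clamp L ((r : ℝ) + h) = r + h := by rw [← NNReal.coe_add, clamp_coe hrh]
      rw [hcl] at h2
      rw [clamp_coe (le_self_add.trans hrh)] at h1
      have e : p (r + k) - p r = W h (R (r + k) - R r - rsmul P 𝕜 k (W r x)) -
          C (R (r + h + k) - R (r + h) - rsmul P 𝕜 k (W (r + h) x)) := by
        simp only [hp, C.map_sub, (W h).map_sub, (W h).map_rsmul, C.map_rsmul, hW.comp,
          add_right_comm (r : ℝ) k h]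
        abel
      rw [e]
      refine (N.gauge_sub_le (hE.mul hD) _ _).trans ((add_le_add
        ((hb.gauge_map_le hD hE hhL _).trans h1) ((hCle _).trans h2)).trans ?_)
      rw [← ENNReal.ofReal_add (by positivity) (by positivity), abs_of_pos hk0]
      exact ENNReal.ofReal_le_ofReal (by linarith)
  exact sub_eq_zero.mp key

/-- `∫₀ᵃ W(r)x dr` lies in the domain of the generator, which maps it to `W(a)x - Cx`. -/
theorem IsCSemigroup.hasDerivAtZero_primitive (hW : N.IsCSemigroup C W) (hE : IsWeight E)
    (hb : N.BoundsOn E W L) (hD : IsWeight D) {x : S} {R : ℝ → S}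
    (hR : N.IsPrimitive D (fun r => W (clamp L r) x) R)
    (hfin : ∀ r, N.gauge D (W (clamp L r) x) ≠ ⊤) {a : ℝ≥0} (ha : a < L) :
    N.HasDerivAtZero C W (R a) (C (W a x - C x)) := by
  have hCle : ∀ u, N.gauge (fun ω => E ω * D ω) (C u) ≤ N.gauge D u := fun u => by
    rw [← hW.zero_apply]
    exact hb.gauge_map_le hD hE zero_le u
  refine N.tendsto_of_tendsto_gauge (hE.mul hD) ?_
  rw [ENNReal.tendsto_nhds_zero]
  intro δ hδ
  obtain ⟨ε, hε, hεδ⟩ : ∃ ε : ℝ, 0 < ε ∧ ENNReal.ofReal (2 * ε) ≤ δ := by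
    rcases eq_or_ne δ ⊤ with rfl | hδt
    · exact ⟨1, one_pos, le_top⟩
    · refine ⟨δ.toReal / 2, half_pos (ENNReal.toReal_pos hδ.ne' hδt), ?_⟩
      rw [mul_div_cancel₀ _ two_ne_zero, ENNReal.ofReal_toReal hδt]
  have hcoe := tendsto_coe_nhdsGT_zero.mono_right (nhdsWithin_le_nhds (s := Set.Ioi (0 : ℝ)))
  filter_upwards [hcoe.eventually (hR.deriv a ε hε), hcoe.eventually (hR.deriv 0 ε hε),
    self_mem_nhdsWithin, nhdsWithin_le_nhds (gt_mem_nhds (tsub_pos_of_lt ha))]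
    with s h1 h2 hs0 hs
  have hs0' : (0 : ℝ) < s := NNReal.coe_pos.mpr hs0
  have has : a + s ≤ L := (lt_tsub_iff_left.mp hs).le
  rw [clamp_coe ha.le] at h1
  rw [clamp_zero, hW.zero_apply, zero_add, hR.zero, sub_zero] at h2
  set u := R (a + s) - R a - rsmul P 𝕜 s (W a x) with hu
  set v := R s - rsmul P 𝕜 s (C x) with hv
  -- By `apply_primitive` the numerator is C applied to the integral over [a, a+s] minus that over
  -- [0, s]; `u` and `v` are the first-order errors of these two integrals.
  have e : rsmul P 𝕜 ((s : ℝ)⁻¹) (W s (R a) - C (R a)) - C (W a x - C x) =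
      C (rsmul P 𝕜 ((s : ℝ)⁻¹) (u - v)) := by
    have e1 : rsmul P 𝕜 ((s : ℝ)⁻¹) (u - v) =
        rsmul P 𝕜 ((s : ℝ)⁻¹) (R (a + s) - R s - R a) - (W a x - C x) := by
      have e2 : u - v = (R (a + s) - R s - R a) - rsmul P 𝕜 s (W a x - C x) := by
        rw [hu, hv, rsmul_sub]; abel
      rw [e2, rsmul_sub, ← mul_rsmul, inv_mul_cancel₀ hs0'.ne', one_rsmul]
    rw [e1, C.map_sub (rsmul _ _ _ _), C.map_rsmul, C.map_sub _ (R a), hW.apply_primitive hE hb hD hR hfin has]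
  show N.gauge _ (rsmul P 𝕜 ((s : ℝ)⁻¹) (W s (R a) - C (R a)) - C (W a x - C x)) ≤ δ
  rw [e]
  refine (hCle _).trans (le_trans ?_ hεδ)
  rw [N.gauge_rsmul]
  calc _ ≤ ENNReal.ofReal |(s : ℝ)⁻¹| * (ENNReal.ofReal (ε * |(s : ℝ)|) +
        ENNReal.ofReal (ε * |(s : ℝ)|)) :=
        mul_le_mul_right ((N.gauge_sub_le hD _ _).trans (add_le_add h1 h2)) _
    _ = ENNReal.ofReal (2 * ε) := by
        rw [← ENNReal.ofReal_add (by positivity) (by positivity),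
          ← ENNReal.ofReal_mul (abs_nonneg _), abs_of_pos hs0', abs_of_pos (inv_pos.mpr hs0')]
        congr 1
        field_simp
        ring

end Semigroup

end RandomNorm

/-! ### Uniqueness for the Cauchy problem and for the semigroup -/

namespace RandomNorm

variable {Ω : Type*} [MeasurableSpace Ω] {P : Measure Ω} {𝕜 : Type*} [RCLike 𝕜]
  {S : Type*} [AddCommGroup S] [Module (Ω →ₘ[P] 𝕜) S] {N : RandomNorm P 𝕜 S}
  [IsProbabilityMeasure P]

theorem IsCSemigroup.exists_primitive (hN : N.IsComplete) {C : N.BoundedOp} {W : ℝ≥0 → N.BoundedOp}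
    (hW : N.IsCSemigroup C W) {L : ℝ≥0} {D E : Ω → ℝ} (hb : N.BoundsOn E W L) (hD : IsWeight D)
    {x : S} (hx : ∀ᵐ ω ∂P, 2 * (E ω * N.norm x ω) ≤ D ω) :
    (∀ r, N.gauge D (W (clamp L r) x) ≠ ⊤) ∧
      ∃ R, N.IsPrimitive D (fun r => W (clamp L r) x) R := by
  have hfin : ∀ r, N.gauge D (W (clamp L r) x) ≠ ⊤ := by
    refine fun r => ne_top_of_le_ne_top ENNReal.one_ne_top (N.gauge_le_one hD ?_)
    filter_upwards [hx, hb _ (clamp_le L r) x, N.ae_norm_nonneg (W (clamp L r) x)] with ω h1 h2 h3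
    linarith
  exact ⟨hfin, N.exists_isPrimitive hN hD hfin fun t => hW.tendsto_gauge hb hD hx t⟩

/-- The Cauchy problem `w' = B w`, `w 0 = 0` for the generator `B` of a `C`-semigroup `V` has only
the trivial solution. -/
theorem IsCSemigroup.eq_zero_of_isPrimitive (hN : N.IsComplete) {C : N.BoundedOp}
    {V : ℝ≥0 → N.BoundedOp} (hV : N.IsCSemigroup C V) {L : ℝ≥0} {D E : Ω → ℝ} (hE : IsWeight E)
    (hb : N.BoundsOn E V L) (hD : IsWeight D) {z w : ℝ → S} (hw : N.IsPrimitive D z w)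
    (hz : ∀ r, ∀ᵐ ω ∂P, 2 * (E ω * N.norm (z r) ω) ≤ D ω)
    (hder : ∀ a : ℝ≥0, a < L → N.HasDerivAtZero C V (w a) (C (z a)))
    {t : ℝ≥0} (ht : t < L) : w t = 0 := by
  have hzfin : ∀ r, N.gauge D (z r) ≠ ⊤ := by
    refine fun r => ne_top_of_le_ne_top ENNReal.one_ne_top (N.gauge_le_one hD ?_)
    filter_upwards [hz r, N.ae_norm_nonneg (z r)] with ω h1 h2
    nlinarith [hE.one_le ω]
  have hfin := fun r => (hV.exists_primitive hN hb hD (hz r)).1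
  choose R hR using fun r => (hV.exists_primitive hN hb hD (hz r)).2
  -- In this form the dependence of V(b)w(a) on `b` is carried by a primitive, differentiable in the
  -- fixed gauge of `D`.
  have hVw : ∀ a : ℝ≥0, a < L → ∀ b ≤ L, V b (w a) = C (w a) + R a b := fun a ha b hb' =>
    hV.eq_add_primitive hE hb hD (hder a ha) (hR a) (hfin a) hb'
  -- The curve V(t-r)w(r) runs from V(t)w(0) = 0 to Cw(t); formally its derivative is V(t-r)z(r) -
  -- V(t-r)z(r) = 0.
  set F : ℝ → S := fun r => V (t - r).toNNReal (w r) with hF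
  have hle : ∀ r ∈ Set.Icc (0 : ℝ) t, (t - r).toNNReal ≤ L := fun r hr =>
    (Real.toNNReal_le_iff_le_coe.mpr (by linarith [hr.1])).trans ht.le
  have hsub : ∀ r ∈ Set.Icc (0 : ℝ) t, ∀ q ∈ Set.Icc (0 : ℝ) t, F q - F r =
      V (t - q).toNNReal (w q - w r) + (R r (t - q) - R r (t - r)) := by
    intro r hr q hq
    have h1 := fun b hb' => hVw r.toNNReal
      ((Real.toNNReal_le_iff_le_coe.mpr hr.2).trans_lt ht) b hb'
    rw [Real.coe_toNNReal r hr.1] at h1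
    have h2 := h1 _ (hle q hq)
    have h3 := h1 _ (hle r hr)
    rw [Real.coe_toNNReal _ (sub_nonneg.mpr hq.2)] at h2
    rw [Real.coe_toNNReal _ (sub_nonneg.mpr hr.2)] at h3
    simp only [hF]
    rw [(V _).map_sub, h2, h3]
    abel
  have key : F t = 0 := by
    refine N.eq_zero_of_frequently_gauge_sub_le (hE.mul hD) (L := t) ?_ (fun r hr => ?_)
      (fun r hr => ?_) (fun r hr ε hε => ?_) ⟨t.2, le_rfl⟩
    · simp only [hF, hw.zero, BoundedOp.map_zero]
    · exact ne_top_of_le_ne_top (hw.gauge_ne_top r) (hb.gauge_map_le hD hE (hle r hr) _)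
    · have hm : Tendsto (fun q : ℝ => t - q) (𝓝 r) (𝓝 (t - r)) :=
        (continuous_const.sub continuous_id).tendsto r
      have h1 := (hw.tendsto hD (hzfin r)).add (((hR r).tendsto hD (hfin r (t - r))).comp hm)
      rw [add_zero] at h1
      refine tendsto_of_tendsto_of_tendsto_of_le_of_le' tendsto_const_nhds
        (h1.mono_left nhdsWithin_le_nhds) (Eventually.of_forall fun _ => zero_le) ?_
      filter_upwards [self_mem_nhdsWithin] with q hq
      rw [hsub r hr q hq]
      exact (N.gauge_add_le (hE.mul hD) _ _).trans (add_le_add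
        (hb.gauge_map_le hD hE (hle q hq) _) (gauge_mul_le hD hE _))
    · have hr' : r ∈ Set.Icc (0 : ℝ) t := ⟨hr.1, hr.2.le⟩
      have hε3 : 0 < ε / 3 := by positivity
      have hneg : Tendsto (fun h : ℝ => -h) (𝓝 0) (𝓝 0) := by
        simpa using (continuous_neg (G := ℝ)).tendsto 0
      have hm : Tendsto (fun h : ℝ => t - (r + h)) (𝓝 0) (𝓝 (t - r)) := by
        have : Tendsto (fun h : ℝ => t - (r + h)) (𝓝 0) (𝓝 (t - (r + 0))) :=
          (continuous_const.sub (continuous_const.add continuous_id)).tendsto 0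
        rwa [add_zero] at this
      refine Eventually.frequently ?_
      filter_upwards [nhdsWithin_le_nhds (hw.deriv r (ε / 3) hε3),
        nhdsWithin_le_nhds (hneg.eventually ((hR r).deriv (t - r) (ε / 3) hε3)),
        nhdsWithin_le_nhds (hm.eventually ((ENNReal.tendsto_nhds_zero.mp
          (hV.tendsto_gauge hb hD (hz r) (t - r))) _ (ENNReal.ofReal_pos.mpr hε3))),
        self_mem_nhdsWithin, nhdsWithin_le_nhds (gt_mem_nhds (sub_pos.mpr hr.2))]
        with h h1 h2 h3 hh hht
      have hh0 : 0 < h := hh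
      have hq : r + h ∈ Set.Icc (0 : ℝ) t := ⟨by linarith [hr.1], by linarith⟩
      refine ⟨hq.2, ?_⟩
      have hcl : ∀ q ∈ Set.Icc (0 : ℝ) t, clamp L (t - q) = (t - q).toNNReal := fun q hq =>
        min_eq_left (hle q hq)
      rw [hcl _ hq, hcl _ hr'] at h3
      rw [hcl _ hr'] at h2
      have e1 : (t : ℝ) - r + -h = t - (r + h) := by ring
      rw [e1] at h2
      -- Three errors of order o(h): differentiating `w`, differentiating the primitive backwards by
      -- `-h`, and the continuity of the orbit of z(r) between t-r-h and t-r.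
      have e : F (r + h) - F r = V (t - (r + h)).toNNReal (w (r + h) - w r - rsmul P 𝕜 h (z r)) +
          ((R r (t - (r + h)) - R r (t - r) - rsmul P 𝕜 (-h) (V (t - r).toNNReal (z r))) +
          rsmul P 𝕜 h (V (t - (r + h)).toNNReal (z r) - V (t - r).toNNReal (z r))) := by
        rw [hsub r hr' _ hq, (V _).map_sub _ (rsmul P 𝕜 h (z r)), (V _).map_rsmul, rsmul_sub,
          neg_rsmul]
        abel
      have h4 : N.gauge D (rsmul P 𝕜 h (V (t - (r + h)).toNNReal (z r) - V (t - r).toNNReal (z r))) ≤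
          ENNReal.ofReal (h * (ε / 3)) := by
        rw [N.gauge_rsmul, abs_of_pos hh0, ENNReal.ofReal_mul hh0.le]
        exact mul_le_mul_right h3 _
      rw [e]
      refine (N.gauge_add_le (hE.mul hD) _ _).trans ((add_le_add
        ((hb.gauge_map_le hD hE (hle _ hq) _).trans h1)
        ((gauge_mul_le hD hE _).trans ((N.gauge_add_le hD _ _).trans (add_le_add h2 h4)))).trans ?_)
      rw [abs_neg, abs_of_pos hh0, ← ENNReal.ofReal_add (by positivity) (by positivity),
        ← ENNReal.ofReal_add (by positivity) (by positivity)]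
      exact ENNReal.ofReal_le_ofReal (by linarith)
  simp only [hF, sub_self, Real.toNNReal_zero, hV.zero_apply] at key
  exact hV.injective (key.trans C.map_zero.symm)

/-- Two locally almost surely bounded `C`-semigroups with the same generator coincide. -/
theorem IsCSemigroup.eq_of_generator_eq (hN : N.IsComplete) {C : N.BoundedOp}
    {W V : ℝ≥0 → N.BoundedOp} (hW : N.IsCSemigroup C W) (hV : N.IsCSemigroup C V)
    (hWb : N.LocallyASBounded W) (hVb : N.LocallyASBounded V)
    (hgen : N.generator C W = N.generator C V) (s : ℝ≥0) : W s = V s := by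
  refine DFunLike.ext _ _ fun x => ?_
  -- Working beyond `s` leaves room for a right derivative there.
  set L : ℝ≥0 := s + 1 with hL
  have hsL : s < L := lt_add_one s
  obtain ⟨M₁, hM₁, hb₁⟩ := hWb.exists_boundsOn (L := L) (by positivity)
  obtain ⟨M₂, hM₂, hb₂⟩ := hVb.exists_boundsOn (L := L) (by positivity)
  set E : Ω → ℝ := fun ω => max 1 (max (M₁ ω) (M₂ ω)) with hEdef
  have hE : IsWeight E := ⟨measurable_const.max (hM₁.max hM₂), fun ω => le_max_left _ _⟩
  replace hb₁ : N.BoundsOn E W L :=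
    hb₁.mono fun ω => (le_max_left _ _).trans (le_max_right _ _)
  replace hb₂ : N.BoundsOn E V L :=
    hb₂.mono fun ω => (le_max_right _ _).trans (le_max_right _ _)
  -- The curve z(r) = W(r)x - V(r)x satisfies ‖z(r)‖ ≤ 2E‖x‖, and its own orbit under `V` must
  -- satisfy 2E‖z(r)‖ ≤ D; this gives 4E²‖x‖.
  set D : Ω → ℝ := fun ω => max 1 (4 * (E ω * (E ω * N.norm x ω))) with hDdef
  have hD : IsWeight D := ⟨measurable_const.max (measurable_const.mul
    (hE.measurable.mul (hE.measurable.mul (N.norm x).measurable))), fun ω => le_max_left _ _⟩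
  have hx : ∀ᵐ ω ∂P, 2 * (E ω * N.norm x ω) ≤ D ω := by
    filter_upwards [N.ae_norm_nonneg x] with ω h
    have h1 := mul_nonneg (hE.pos ω).le h
    have h2 := le_mul_of_one_le_left h1 (hE.one_le ω)
    exact le_trans (by linarith) (le_max_right _ _)
  obtain ⟨hf₁, p, hp⟩ := hW.exists_primitive hN hb₁ hD hx
  obtain ⟨hf₂, q, hq⟩ := hV.exists_primitive hN hb₂ hD hx
  have hpq := hp.sub hD hq
  have hz : ∀ r, ∀ᵐ ω ∂P, 2 * (E ω * N.norm (W (clamp L r) x - V (clamp L r) x) ω) ≤ D ω := by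
    intro r
    filter_upwards [hb₁ _ (clamp_le L r) x, hb₂ _ (clamp_le L r) x,
      N.ae_norm_sub_le (W (clamp L r) x) (V (clamp L r) x)] with ω h1 h2 h3
    have h4 := mul_le_mul_of_nonneg_left (h3.trans (add_le_add h1 h2)) (hE.pos ω).le
    exact le_trans (by linarith) (le_max_right _ _)
  have hder : ∀ a : ℝ≥0, a < L →
      N.HasDerivAtZero C V (p a - q a) (C (W (clamp L a) x - V (clamp L a) x)) := by
    intro a ha
    have h1 := hW.hasDerivAtZero_primitive hE hb₁ hD hp hf₁ ha
    -- The only use of the equality of generators: the primitive of the `W`-orbit becomes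
    -- differentiable along `V`. The terms Cx then cancel in the difference.
    rw [← mem_generator_iff hW, hgen, mem_generator_iff hV] at h1
    have h2 := h1.sub (hV.hasDerivAtZero_primitive hE hb₂ hD hq hf₂ ha)
    rw [← C.map_sub, sub_sub_sub_cancel_right] at h2
    rwa [clamp_coe ha.le]
  have hzero : ∀ a : ℝ≥0, a < L → p a - q a = 0 := fun a ha =>
    hV.eq_zero_of_isPrimitive hN hE hb₂ hD hpq hz hder ha
  have hsmall : ∀ ε : ℝ, 0 < ε → N.gauge D (W s x - V s x) ≤ ENNReal.ofReal ε := by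
    intro ε hε
    -- Since w vanishes at both `s` and `s + h`, its first-order error at `s` is just -h(W(s)x -
    -- V(s)x); dividing by `h` leaves a gauge of at most `ε`.
    obtain ⟨h, h1, hh, hh1⟩ := (((tendsto_coe_nhdsGT_zero.mono_right
      nhdsWithin_le_nhds).eventually (hpq.deriv s ε hε)).and (Eventually.and self_mem_nhdsWithin
        (nhdsWithin_le_nhds (gt_mem_nhds one_pos)))).exists
    have hh0 : (0 : ℝ) < h := NNReal.coe_pos.mpr hh
    have h2 := hzero (s + h) ((add_lt_add_iff_left s).mpr hh1)
    rw [NNReal.coe_add] at h2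
    rw [h2, hzero s hsL, sub_zero, zero_sub, N.gauge_neg, N.gauge_rsmul, abs_of_pos hh0,
      clamp_coe hsL.le, mul_comm ε, ENNReal.ofReal_mul hh0.le] at h1
    exact (ENNReal.mul_le_mul_iff_right (ENNReal.ofReal_pos.mpr hh0).ne' ENNReal.ofReal_ne_top).mp h1
  refine sub_eq_zero.mp (N.eq_zero_of_gauge_eq_zero hD (le_antisymm ?_ zero_le))
  refine ENNReal.le_of_forall_pos_le_add fun ε hε _ => ?_
  rw [zero_add, ← ENNReal.ofReal_coe_nnreal]
  exact hsmall ε (NNReal.coe_pos.mpr hε)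

end RandomNorm

theorem proposition4p4 {Ω : Type*} [MeasurableSpace Ω] (P : Measure Ω) [IsProbabilityMeasure P]
    (𝕜 : Type*) [RCLike 𝕜] (S : Type*) [AddCommGroup S] [Module (Ω →ₘ[P] 𝕜) S]
    (N : RandomNorm P 𝕜 S) (hN : N.IsComplete)
    (C : N.BoundedOp) (W V : ℝ≥0 → N.BoundedOp)
    (hW : N.IsCSemigroup C W) (hV : N.IsCSemigroup C V)
    (hWb : N.LocallyASBounded W) (hVb : N.LocallyASBounded V)
    (hgen : N.generator C W = N.generator C V) :
    ∀ s : ℝ≥0, W s = V s :=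
  hW.eq_of_generator_eq hN hV hWb hVb hgen
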